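/- For $K=\mathbb{C}$ or $K=\mathbb{R}$ let $\mathfrak{g}(K)=\mathfrak{sl}(8,K)\oplus\bigwedge^4K^8$ with the bracket $$[A+u,\,B+v]=\bigl([A,B]+\mu(u,v)\bigr)+\bigl(A\cdot v-B\cdot u\bigr)\qquad (A,B\in\mathfrak{sl}(8,K),\ u,v\in\textstyle\bigwedge^4K^8),$$ where $A\cdot v$ is the natural action of $\mathfrak{sl}(8,K)$ on $\bigwedge^4K^8$ (by derivations), and $\mu(u,v)\in\mathfrak{sl}(8,K)$ is determined by $\operatorname{tr}(\mu(u,v)A)\;v_1\wedge\cdots\wedge v_8=(A\cdot u)\wedge v$ for all $A\in\mathfrak{sl}(8,K)$, with $v_1,\dots,v_8$ the standard basis of $K^8$. Then $\mathfrak{g}=\mathfrak{g}(\mathbb{C})$ is the simple Lie algebra of type $E_7$, and $\mathfrak{g}^{\mathbb{R}}=\mathfrak{g}(\mathbb{R})$ is the real span of a Chevalley basis of $\mathfrak{g}$. Let $\theta$ be the involutive automorphism $A+u\mapsto A-u$, and let $\mathfrak{g}_0=\mathfrak{sl}(8,\mathbb{C})$, $\mathfrak{g}_1=\bigwedge^4\mathbb{C}^8$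 (respectively $\mathfrak{g}_0^{\mathbb{R}}=\mathfrak{sl}(8,\mathbb{R})$, $\mathfrak{g}_1^{\mathbb{R}}=\bigwedge^4\mathbb{R}^8$) be its eigenspaces for the eigenvalues $1$ and $-1$. The group $\mathrm{SL}(8,K)$ acts on $\mathfrak{g}(K)$ by the automorphisms $g\cdot(A+u)=gAg^{-1}+(\bigwedge^4g)(u)$. An element $e$ is called nilpotent if $\operatorname{ad}e$ is nilpotent. An $\mathfrak{sl}_2$-triple is a triple $(h,e,f)$ with $[h,e]=2e$, $[h,f]=-2f$, $[e,f]=h$ (the zero triple is allowed); it is called homogeneous if $h\in\mathfrak{g}_0$ and $e,f\in\mathfrak{g}_1$ (respectively $h\in\mathfrak{g}_0^{\mathbb{R}}$ and $e,f\in\mathfrak{g}_1^{\mathbb{R}}$). Theorem. 1. Let $e\in\mathfrak{g}_1$ be nilpotent. Then there are $h\in\mathfrak{g}_0$ and $f\in\mathfrak{g}_1$ such that $(h,e,f)$ is an $\mathfrak{sl}_2$-triple. Moreover, if $e,e'\in\mathfrak{g}_1$ lie in homogeneous $\mathfrak{sl}_2$-triples $(h,e,f)$, $(h',e',f')$, then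 $e,e'$ are $\mathrm{SL}(8,\mathbb{C})$-conjugate if and only if there is a $g\in\mathrm{SL}(8,\mathbb{C})$ such that $g\cdot h'=h$, $g\cdot e'=e$, $g\cdot f'=f$. 2. Let $e\in\mathfrak{g}_1^{\mathbb{R}}$ be nilpotent. Then there are $h\in\mathfrak{g}_0^{\mathbb{R}}$ and $f\in\mathfrak{g}_1^{\mathbb{R}}$ such that $(h,e,f)$ is an $\mathfrak{sl}_2$-triple. Moreover, if $e,e'\in\mathfrak{g}_1^{\mathbb{R}}$ lie in homogeneous $\mathfrak{sl}_2$-triples $(h,e,f)$, $(h',e',f')$ of $\mathfrak{g}^{\mathbb{R}}$, then $e,e'$ are $\mathrm{SL}(8,\mathbb{R})$-conjugate if and only if there is a $g\in\mathrm{SL}(8,\mathbb{R})$ such that $g\cdot h'=h$, $g\cdot e'=e$, $g\cdot f'=f$. -/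

import Mathlib

namespace SplitE7

noncomputable section

/-- The derivation extension of an endomorphism `A` to an alternating map `f`:
`v ↦ ∑ k, f (v₁, …, A v_k, …, v_n)`. -/
def derivAlt {K M N ι : Type*} [CommRing K] [AddCommGroup M] [Module K M] [AddCommGroup N]
    [Module K N] [Fintype ι] [hι : DecidableEq ι] (f : M [⋀^ι]→ₗ[K] N) (A : M →ₗ[K] M) :
    M [⋀^ι]→ₗ[K] N where
  toFun v := ∑ k, f (Function.update v k (A (v k)))
  map_update_add' := by
    intro d v i x y
    obtain rfl := Subsingleton.elim hι d
    rw [← Finset.sum_add_distrib]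
    refine Finset.sum_congr rfl fun k _ => ?_
    by_cases h : k = i
    · subst h
      simp
    · simp only [Function.update_of_ne h, Function.update_comm (Ne.symm h), f.map_update_add]
  map_update_smul' := by
    intro d v i c x
    obtain rfl := Subsingleton.elim hι d
    rw [Finset.smul_sum]
    refine Finset.sum_congr rfl fun k _ => ?_
    by_cases h : k = i
    · subst h
      simp
    · simp only [Function.update_of_ne h, Function.update_comm (Ne.symm h), f.map_update_smul]
  map_eq_zero_of_eq' := by
    intro v i j hv hij
    rw [Finset.sum_eq_add i j hij]
    · have : Function.update v j (A (v j)) = Function.update v i (A (v i)) ∘ Equiv.swap i j := by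
        funext k
        simp only [Function.comp_apply, Function.update_apply, Equiv.swap_apply_def]
        split_ifs <;> simp_all
      rw [this, f.map_swap _ hij]
      simp
    · intro k _ hk
      apply f.map_eq_zero_of_eq _ _ hij
      rw [Function.update_of_ne hk.1.symm, Function.update_of_ne hk.2.symm, hv]
    · simp
    · simp

theorem derivAlt_apply {K M N ι : Type*} [CommRing K] [AddCommGroup M] [Module K M]
    [AddCommGroup N] [Module K N] [Fintype ι] [DecidableEq ι] (f : M [⋀^ι]→ₗ[K] N)
    (A : M →ₗ[K] M) (v : ι → M) :
    derivAlt f A v = ∑ k, f (Function.update v k (A (v k))) := rfl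

theorem derivAlt_lie {K M N ι : Type*} [CommRing K] [AddCommGroup M] [Module K M]
    [AddCommGroup N] [Module K N] [Fintype ι] [DecidableEq ι] (f : M [⋀^ι]→ₗ[K] N)
    (A B : M →ₗ[K] M) :
    derivAlt f (A * B - B * A) = derivAlt (derivAlt f A) B - derivAlt (derivAlt f B) A := by
  ext v
  have key : ∀ C D : M →ₗ[K] M, derivAlt (derivAlt f D) C v =
      ∑ k, f (Function.update v k (D (C (v k)))) +
      ∑ k, ∑ l, if l = k then 0 else
        f (Function.update (Function.update v k (C (v k))) l (D (v l))) := by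
    intro C D
    simp only [derivAlt_apply, ← Finset.sum_add_distrib]
    refine Finset.sum_congr rfl fun k _ => ?_
    rw [← Finset.add_sum_erase _ _ (Finset.mem_univ k),
      ← Finset.add_sum_erase _ (fun l => if l = k then 0 else _) (Finset.mem_univ k)]
    simp only [Function.update_self, Function.update_idem, if_true, zero_add]
    congr 1
    refine Finset.sum_congr rfl fun l hl => ?_
    rw [if_neg (Finset.ne_of_mem_erase hl), Function.update_of_ne (Finset.ne_of_mem_erase hl)]
  have sym : (∑ k, ∑ l, if l = k then 0 else
        f (Function.update (Function.update v k (A (v k))) l (B (v l)))) =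
      ∑ k, ∑ l, if l = k then 0 else
        f (Function.update (Function.update v k (B (v k))) l (A (v l))) := by
    rw [Finset.sum_comm]
    refine Finset.sum_congr rfl fun k _ => Finset.sum_congr rfl fun l _ => ?_
    by_cases h : k = l
    · simp [h]
    · rw [if_neg h, if_neg (Ne.symm h), Function.update_comm h]
  rw [AlternatingMap.sub_apply, key, key, sym, derivAlt_apply]
  simp [AlternatingMap.map_update_sub, Finset.sum_sub_distrib]

/-- The Lie algebra representation of the `8 × 8` matrices on `⋀⁴ K⁸`:
`A · (v₁ ∧ v₂ ∧ v₃ ∧ v₄) = A v₁ ∧ v₂ ∧ v₃ ∧ v₄ + ⋯ + v₁ ∧ v₂ ∧ v₃ ∧ A v₄`. -/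
def act (K : Type*) [Field K] :
    Matrix (Fin 8) (Fin 8) K →ₗ[K] Module.End K (⋀[K]^4 (Fin 8 → K)) where
  toFun A := exteriorPower.alternatingMapLinearEquiv
    (derivAlt (exteriorPower.ιMulti K 4) (Matrix.toLin' A))
  map_add' A B := by
    rw [← map_add]
    congr 1
    ext v
    simp [derivAlt_apply, AlternatingMap.map_update_add, Finset.sum_add_distrib]
  map_smul' c A := by
    rw [RingHom.id_apply, ← map_smul]
    congr 1
    ext v
    simp [derivAlt_apply, AlternatingMap.map_update_smul, Finset.smul_sum]

theorem act_ιMulti {K : Type*} [Field K] (A : Matrix (Fin 8) (Fin 8) K) (v : Fin 4 → Fin 8 → K) :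
    act K A (exteriorPower.ιMulti K 4 v) =
      ∑ k, exteriorPower.ιMulti K 4 (Function.update v k (A.mulVec (v k))) := by
  simp [act, derivAlt_apply]

theorem act_commutator {K : Type*} [Field K] (A B : Matrix (Fin 8) (Fin 8) K)
    (w : ⋀[K]^4 (Fin 8 → K)) :
    act K (A * B - B * A) w = act K A (act K B w) - act K B (act K A w) := by
  have : act K (A * B - B * A) = (act K A).comp (act K B) - (act K B).comp (act K A) := by
    apply exteriorPower.linearMap_ext
    ext1 v
    have h := congrArg (fun f => f v) (derivAlt_lie (exteriorPower.ιMulti K 4)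
      (Matrix.toLin' A) (Matrix.toLin' B))
    have h2 : Matrix.toLin' (A * B - B * A) =
      Matrix.toLin' A * Matrix.toLin' B - Matrix.toLin' B * Matrix.toLin' A := by
      rw [map_sub, Matrix.toLin'_mul, Matrix.toLin'_mul]; rfl
    rw [← h2] at h
    simp only [derivAlt_apply, AlternatingMap.sub_apply, Matrix.toLin'_apply] at h
    simp only [LinearMap.compAlternatingMap_apply, LinearMap.sub_apply, LinearMap.comp_apply,
      act_ιMulti, map_sum, h]
  rw [this]; rfl

/-- The volume form on the exterior algebra of `K⁸`, i.e. the coefficient of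
`v₁ ∧ ⋯ ∧ v₈`, where `v₁, …, v₈` is the standard basis. -/
def vol (K : Type*) [Field K] : ExteriorAlgebra K (Fin 8 → K) →ₗ[K] K :=
  ExteriorAlgebra.liftAlternating (Pi.single 8 Matrix.detRowAlternating)

theorem vol_ιMulti {K : Type*} [Field K] (c : Fin 8 → Fin 8 → K) :
    vol K (ExteriorAlgebra.ιMulti K 8 c) = Matrix.det c := by
  rw [vol, ExteriorAlgebra.liftAlternating_apply_ιMulti, Pi.single_eq_same]
  unfold Matrix.det
  congr 1

/-- The pairing `(u, v) ↦ vol (u ∧ v)` on `⋀⁴ K⁸`. -/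
def pairing (K : Type*) [Field K] :
    ⋀[K]^4 (Fin 8 → K) →ₗ[K] ⋀[K]^4 (Fin 8 → K) →ₗ[K] K :=
  ((LinearMap.mul K (ExteriorAlgebra K (Fin 8 → K))).compr₂ (vol K)).domRestrict₁₂ _ _

theorem pairing_apply {K : Type*} [Field K] (u v : ⋀[K]^4 (Fin 8 → K)) :
    pairing K u v = vol K ((u : ExteriorAlgebra K (Fin 8 → K)) * v) := rfl

theorem pairing_ιMulti {K : Type*} [Field K] (a b : Fin 4 → Fin 8 → K) :
    pairing K (exteriorPower.ιMulti K 4 a) (exteriorPower.ιMulti K 4 b) =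
      Matrix.det (Fin.append a b : Fin 8 → Fin 8 → K) := by
  rw [pairing_apply, exteriorPower.ιMulti_apply_coe, exteriorPower.ιMulti_apply_coe,
    ExteriorAlgebra.ιMulti_mul_ιMulti]
  exact vol_ιMulti _

/-- The matrix `M u v` with `tr (M u v * A) = vol ((A · u) ∧ v)` for all matrices `A`. -/
def moment (K : Type*) [Field K] :
    ⋀[K]^4 (Fin 8 → K) →ₗ[K] ⋀[K]^4 (Fin 8 → K) →ₗ[K] Matrix (Fin 8) (Fin 8) K :=
  LinearMap.mk₂ K
    (fun u v => Matrix.of fun i j => pairing K (act K (Matrix.single j i 1) u) v)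
    (fun u u' v => by ext i j; simp) (fun c u v => by ext i j; simp)
    (fun u v v' => by ext i j; simp) (fun c u v => by ext i j; simp)

theorem moment_apply {K : Type*} [Field K] (u v : ⋀[K]^4 (Fin 8 → K)) (i j : Fin 8) :
    moment K u v i j = pairing K (act K (Matrix.single j i 1) u) v := rfl

theorem trace_moment_mul {K : Type*} [Field K] (u v : ⋀[K]^4 (Fin 8 → K))
    (A : Matrix (Fin 8) (Fin 8) K) :
    (moment K u v * A).trace = pairing K (act K A u) v := by
  conv_rhs => rw [Matrix.matrix_eq_sum_single A]
  simp only [map_sum, LinearMap.sum_apply, Matrix.trace, Matrix.diag, Matrix.mul_apply,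
    moment_apply]
  rw [Finset.sum_comm]
  refine Finset.sum_congr rfl fun i _ => Finset.sum_congr rfl fun j _ => ?_
  have : Matrix.single i j (A i j) = A i j • Matrix.single i j (1 : K) := by simp
  rw [this, map_smul, LinearMap.smul_apply, map_smul, LinearMap.smul_apply, smul_eq_mul, mul_comm]

theorem pairing_comm {K : Type*} [Field K] (u v : ⋀[K]^4 (Fin 8 → K)) :
    pairing K u v = pairing K v u := by
  have : pairing K = (pairing K).flip := by
    apply exteriorPower.linearMap_ext
    ext1 a
    apply exteriorPower.linearMap_ext
    ext1 b
    simp only [LinearMap.compAlternatingMap_apply, LinearMap.flip_apply, pairing_ιMulti]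
    have h : (Fin.append a b : Fin 8 → Fin 8 → K) =
        (Fin.append b a : Fin 8 → Fin 8 → K) ∘ (finAddFlip : Fin (4 + 4) ≃ Fin (4 + 4)) := by
      funext i
      refine Fin.addCases (m := 4) (n := 4) (fun i => ?_) (fun i => ?_) i
      · rw [Function.comp_apply, finAddFlip_apply_castAdd]
        simp only [Fin.append_left, Fin.append_right]
      · rw [Function.comp_apply, finAddFlip_apply_natAdd]
        simp only [Fin.append_left, Fin.append_right]
    have hs : Equiv.Perm.sign (finAddFlip : Fin (4 + 4) ≃ Fin (4 + 4)) = 1 := by decide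
    have h2 := Matrix.det_permute (finAddFlip : Fin (4 + 4) ≃ Fin (4 + 4))
      (Fin.append b a : Fin (4 + 4) → Fin (4 + 4) → K)
    rw [hs] at h2
    rw [h]
    refine h2.trans ?_
    simp
  conv_lhs => rw [this]
  rfl

theorem sum_det_update {K : Type*} [Field K] (A C : Matrix (Fin 8) (Fin 8) K) :
    ∑ k, (C.updateRow k (A.mulVec (C k))).det = A.trace * C.det := by
  have h : ∀ k, (C.updateRow k (A.mulVec (C k))).det =
      (C.transpose.adjugate * (A * C.transpose)) k k := by
    intro k
    rw [← Matrix.cramer_transpose_apply, Matrix.cramer_eq_adjugate_mulVec, Matrix.mul_apply]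
    rfl
  have h2 : ∑ k, (C.transpose.adjugate * (A * C.transpose)) k k =
      (C.transpose.adjugate * (A * C.transpose)).trace := rfl
  rw [Finset.sum_congr rfl fun k _ => h k, h2, Matrix.trace_mul_comm, mul_assoc,
    Matrix.mul_adjugate, Matrix.det_transpose, Matrix.mul_smul, mul_one, Matrix.trace_smul,
    smul_eq_mul, mul_comm]

theorem append_update_left {α : Type*} (a b : Fin 4 → α) (k : Fin 4) (x : α) :
    (Fin.append (Function.update a k x) b : Fin 8 → α) =
      Function.update (Fin.append a b : Fin 8 → α) (Fin.castAdd 4 k : Fin (4 + 4)) x := by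
  funext i
  refine Fin.addCases (m := 4) (n := 4) (fun i => ?_) (fun i => ?_) i
  · by_cases h : i = k
    · subst h
      simp only [Fin.append_left, Function.update_self]
    · rw [Fin.append_left, Function.update_of_ne h, Function.update_of_ne, Fin.append_left]
      exact fun h' => h (Fin.castAdd_injective 4 4 h')
  · rw [Fin.append_right, Function.update_of_ne, Fin.append_right]
    intro h
    have := congrArg Fin.val h
    simp only [Fin.val_natAdd, Fin.val_castAdd] at this
    omega

theorem append_update_right {α : Type*} (a b : Fin 4 → α) (k : Fin 4) (x : α) :
    (Fin.append a (Function.update b k x) : Fin 8 → α) =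
      Function.update (Fin.append a b : Fin 8 → α) (Fin.natAdd 4 k : Fin (4 + 4)) x := by
  funext i
  refine Fin.addCases (m := 4) (n := 4) (fun i => ?_) (fun i => ?_) i
  · rw [Fin.append_left, Function.update_of_ne, Fin.append_left]
    intro h
    have := congrArg Fin.val h
    simp only [Fin.val_natAdd, Fin.val_castAdd] at this
    omega
  · by_cases h : i = k
    · subst h
      simp only [Fin.append_right, Function.update_self]
    · rw [Fin.append_right, Function.update_of_ne h, Function.update_of_ne, Fin.append_right]
      exact fun h' => h (Fin.natAdd_injective 4 4 h')

theorem sum_fin_eight {N : Type*} [AddCommMonoid N] (g : Fin 8 → N) :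
    ∑ k, g k = ∑ k : Fin 4, g (Fin.castAdd 4 k : Fin (4 + 4)) +
      ∑ k : Fin 4, g (Fin.natAdd 4 k : Fin (4 + 4)) :=
  Fin.sum_univ_add (a := 4) (b := 4) g

theorem pairing_act {K : Type*} [Field K] (A : Matrix (Fin 8) (Fin 8) K)
    (u v : ⋀[K]^4 (Fin 8 → K)) :
    pairing K (act K A u) v + pairing K u (act K A v) = A.trace * pairing K u v := by
  have : (pairing K).comp (act K A) + (pairing K).compl₂ (act K A) = A.trace • pairing K := by
    apply exteriorPower.linearMap_ext
    ext1 a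
    apply exteriorPower.linearMap_ext
    ext1 b
    have hp := pairing_ιMulti a b
    have hl := append_update_left a b
    have hr := append_update_right a b
    have hl' : ∀ k, (Fin.append a b : Fin 8 → Fin 8 → K) (Fin.castAdd 4 k : Fin (4 + 4)) = a k :=
      fun k => Fin.append_left a b k
    have hr' : ∀ k, (Fin.append a b : Fin 8 → Fin 8 → K) (Fin.natAdd 4 k : Fin (4 + 4)) = b k :=
      fun k => Fin.append_right a b k
    generalize (Fin.append a b : Fin 8 → Fin 8 → K) = c at hp hl hr hl' hr'
    have h6 := sum_det_update A c
    have h0 := sum_fin_eight fun k => (Matrix.updateRow c k (A.mulVec (c k))).det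
    have e1 : ∑ k : Fin 4, (Matrix.updateRow c (Fin.castAdd 4 k : Fin (4 + 4))
        (A.mulVec (c (Fin.castAdd 4 k : Fin (4 + 4))))).det =
        pairing K (act K A (exteriorPower.ιMulti K 4 a)) (exteriorPower.ιMulti K 4 b) := by
      rw [act_ιMulti, map_sum, LinearMap.sum_apply]
      refine Finset.sum_congr rfl fun k _ => ?_
      rw [pairing_ιMulti, hl, hl']; rfl
    have e2 : ∑ k : Fin 4, (Matrix.updateRow c (Fin.natAdd 4 k : Fin (4 + 4))
        (A.mulVec (c (Fin.natAdd 4 k : Fin (4 + 4))))).det =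
        pairing K (exteriorPower.ιMulti K 4 a) (act K A (exteriorPower.ιMulti K 4 b)) := by
      rw [act_ιMulti, map_sum]
      refine Finset.sum_congr rfl fun k _ => ?_
      rw [pairing_ιMulti, hr, hr']; rfl
    have h3 := (congrArg₂ (· + ·) e1.symm e2.symm).trans (h0.symm.trans h6)
    exact h3.trans (congrArg (A.trace * ·) hp.symm)
  exact LinearMap.congr_fun₂ this u v

theorem act_one {K : Type*} [Field K] (u : ⋀[K]^4 (Fin 8 → K)) :
    act K 1 u = (4 : K) • u := by
  have : act K 1 = (4 : K) • (LinearMap.id : Module.End K (⋀[K]^4 (Fin 8 → K))) := by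
    apply exteriorPower.linearMap_ext
    ext1 a
    simp only [LinearMap.compAlternatingMap_apply, act_ιMulti]
    simp [← Nat.cast_smul_eq_nsmul K]
  rw [this]; rfl

theorem trace_moment {K : Type*} [Field K] (u v : ⋀[K]^4 (Fin 8 → K)) :
    (moment K u v).trace = 4 * pairing K u v := by
  have := trace_moment_mul u v 1
  rw [mul_one, act_one] at this
  simpa using this

theorem moment_add_moment {K : Type*} [Field K] (u v : ⋀[K]^4 (Fin 8 → K)) :
    moment K u v + moment K v u = pairing K u v • (1 : Matrix (Fin 8) (Fin 8) K) := by
  ext i j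
  have := pairing_act (Matrix.single j i 1) u v
  rw [pairing_comm u] at this
  simp only [Matrix.add_apply, moment_apply, this, Matrix.smul_apply, Matrix.one_apply]
  by_cases h : i = j
  · subst h; simp
  · simp [h, Matrix.trace_single_eq_of_ne _ _ _ (Ne.symm h)]

theorem moment_act {K : Type*} [Field K] (A : Matrix (Fin 8) (Fin 8) K)
    (u v : ⋀[K]^4 (Fin 8 → K)) :
    moment K (act K A u) v + moment K u (act K A v) =
      A * moment K u v - moment K u v * A + A.trace • moment K u v := by
  have hx : ∀ X Y : Matrix (Fin 8) (Fin 8) K,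
      (∀ B, (X * B).trace = (Y * B).trace) → X = Y := by
    intro X Y h
    ext i j
    simpa [Matrix.trace_mul_single] using h (Matrix.single j i 1)
  apply hx
  intro B
  have h1 := pairing_act A (act K B u) v
  have h2 := act_commutator B A u
  have h3 : ((A * moment K u v - moment K u v * A) * B).trace =
      (moment K u v * (B * A - A * B)).trace := by
    rw [sub_mul, mul_sub, Matrix.trace_sub, Matrix.trace_sub, ← mul_assoc, ← mul_assoc,
      Matrix.trace_mul_cycle A, Matrix.trace_mul_cycle B A]
  rw [add_mul, add_mul, Matrix.trace_add, Matrix.trace_add, trace_moment_mul, trace_moment_mul,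
    h3, trace_moment_mul, Matrix.smul_mul, Matrix.trace_smul, trace_moment_mul, h2, map_sub,
    LinearMap.sub_apply, smul_eq_mul]
  linear_combination h1

/-- The basis four-vector `v_{α 0} ∧ v_{α 1} ∧ v_{α 2} ∧ v_{α 3}`. -/
def word (K : Type*) [Field K] (α : Fin 4 → Fin 8) : ⋀[K]^4 (Fin 8 → K) :=
  exteriorPower.ιMulti K 4 fun k => Pi.single (α k) 1

theorem word_eq_zero {K : Type*} [Field K] {α : Fin 4 → Fin 8} (h : ¬ Function.Injective α) :
    word K α = 0 := by
  apply AlternatingMap.map_eq_zero_of_not_injective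
  intro h'
  apply h
  intro i j hij
  exact h' (by simp only [hij])

theorem word_comp_perm {K : Type*} [Field K] (α : Fin 4 → Fin 8) (σ : Equiv.Perm (Fin 4)) :
    word K (α ∘ σ) = Equiv.Perm.sign σ • word K α :=
  AlternatingMap.map_perm (exteriorPower.ιMulti K 4) (fun k => Pi.single (α k) 1) σ

theorem span_words {K : Type*} [Field K] (N : Submodule K (⋀[K]^4 (Fin 8 → K)))
    (h : ∀ α, Function.Injective α → word K α ∈ N) (u : ⋀[K]^4 (Fin 8 → K)) : u ∈ N := by
  have hs := exteriorPower.ιMulti_span_of_span K 4 (Fin 8 → K)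
    (s := Set.range (Pi.basisFun K (Fin 8))) (Module.Basis.span_eq _)
  have hu : u ∈ (⊤ : Submodule K (⋀[K]^4 (Fin 8 → K))) := trivial
  rw [← hs] at hu
  refine Submodule.span_le.2 ?_ hu
  rintro _ ⟨a, ha, rfl⟩
  have : ∀ k, ∃ i, a k = Pi.single i 1 := by
    intro k
    obtain ⟨i, hi⟩ := ha (Set.mem_range_self k)
    exact ⟨i, by rw [← hi, Pi.basisFun_apply]⟩
  choose α hα using this
  have ha' : a = fun k => Pi.single (α k) 1 := funext hα
  rw [ha']
  by_cases hi : Function.Injective α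
  · exact h α hi
  · have := word_eq_zero (K := K) hi
    rw [word] at this
    rw [this]
    exact N.zero_mem

theorem act_single_word {K : Type*} [Field K] (x y : Fin 8) (α : Fin 4 → Fin 8) :
    act K (Matrix.single x y 1) (word K α) =
      ∑ k, if α k = y then word K (Function.update α k x) else 0 := by
  rw [word, act_ιMulti]
  refine Finset.sum_congr rfl fun k _ => ?_
  split_ifs with h
  · rw [word]
    congr 1
    funext l
    by_cases hl : l = k
    · subst hl
      rw [Function.update_self, Function.update_self, h]
      ext i
      simp [Matrix.single_apply, Pi.single_apply, eq_comm]
    · rw [Function.update_of_ne hl, Function.update_of_ne hl]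
  · have : (Matrix.single x y (1 : K)).mulVec (Pi.single (α k) 1) = 0 := by
      ext i
      simp [Ne.symm h]
    rw [this, AlternatingMap.map_update_zero]

theorem mem_of_exchange {K : Type*} [Field K] (N : Submodule K (⋀[K]^4 (Fin 8 → K)))
    (α : Fin 4 → Fin 8) (hN : word K α ∈ N)
    (P : Finset (Fin 8) → Prop) (R : Fin 8 → Fin 8 → Prop)
    (hR : ∀ x y, R x y → ∀ u ∈ N, act K (Matrix.single x y 1) u ∈ N)
    (hP : ∀ s : Finset (Fin 8), s.card = 4 → P s → s ≠ Finset.univ.image α →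
      ∃ x ∈ s, ∃ y ∈ Finset.univ.image α, x ∉ Finset.univ.image α ∧ y ∉ s ∧
        P (insert y (s.erase x)) ∧ R x y)
    (γ : Fin 4 → Fin 8) (hγ : Function.Injective γ) (hPγ : P (Finset.univ.image γ)) :
    word K γ ∈ N := by
  induction hn : (Finset.univ.image γ \ Finset.univ.image α).card using Nat.strong_induction_on
    generalizing γ with
  | _ n ih =>
  by_cases hs : Finset.univ.image γ = Finset.univ.image α
  · have : ∀ k, ∃ l, α l = γ k := by
      intro k
      have hk : γ k ∈ Finset.univ.image γ := Finset.mem_image_of_mem _ (Finset.mem_univ k)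
      rw [hs] at hk
      simpa using hk
    choose σ hσ using this
    have hinj : Function.Injective σ := by
      intro i j hij
      apply hγ
      rw [← hσ, ← hσ, hij]
    have hγ' : γ = α ∘ (Equiv.ofBijective σ (Finite.injective_iff_bijective.1 hinj)) := by
      funext k
      exact (hσ k).symm
    rw [hγ', word_comp_perm]
    rcases Int.units_eq_one_or (Equiv.Perm.sign
      (Equiv.ofBijective σ (Finite.injective_iff_bijective.1 hinj))) with h | h
    · rw [h, one_smul]; exact hN
    · rw [h, Units.neg_smul, one_smul]; exact N.neg_mem hN
  · obtain ⟨x, hx, y, hy, hxα, hyγ, hP', hxy⟩ := hP _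
      (by rw [Finset.card_image_of_injective _ hγ]; simp) hPγ hs
    obtain ⟨j, -, rfl⟩ := Finset.mem_image.1 hx
    have hyγ' : ∀ k, γ k ≠ y := fun k hk => hyγ (hk ▸ Finset.mem_image_of_mem _ (Finset.mem_univ k))
    have hinj : Function.Injective (Function.update γ j y) := by
      intro k l hkl
      by_cases hk : k = j <;> by_cases hl : l = j
      · rw [hk, hl]
      · subst hk
        rw [Function.update_self, Function.update_of_ne hl] at hkl
        exact absurd hkl.symm (hyγ' l)
      · subst hl
        rw [Function.update_self, Function.update_of_ne hk] at hkl
        exact absurd hkl (hyγ' k)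
      · rw [Function.update_of_ne hl, Function.update_of_ne hk] at hkl
        exact hγ hkl
    have himg : Finset.univ.image (Function.update γ j y) =
        insert y ((Finset.univ.image γ).erase (γ j)) := by
      ext z
      simp only [Finset.mem_image, Finset.mem_univ, true_and, Finset.mem_insert, Finset.mem_erase]
      constructor
      · rintro ⟨k, rfl⟩
        by_cases hk : k = j
        · subst hk; left; simp
        · right
          rw [Function.update_of_ne hk]
          exact ⟨fun h => hk (hγ h), k, rfl⟩
      · rintro (rfl | ⟨hz, k, rfl⟩)
        · exact ⟨j, by simp⟩
        · exact ⟨k, Function.update_of_ne (fun h => hz (by rw [h])) _ _⟩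
    have hlt : (Finset.univ.image (Function.update γ j y) \ Finset.univ.image α).card < n := by
      rw [← hn]
      apply Finset.card_lt_card
      rw [himg, Finset.ssubset_iff_of_subset]
      · exact ⟨γ j, Finset.mem_sdiff.2 ⟨hx, hxα⟩, by
          simp only [Finset.mem_sdiff, Finset.mem_insert, Finset.mem_erase, not_and]
          intro h
          rcases h with h | h
          · exact absurd h (hyγ' j)
          · exact absurd rfl h.1⟩
      · intro z hz
        simp only [Finset.mem_sdiff, Finset.mem_insert, Finset.mem_erase] at hz ⊢
        rcases hz with ⟨rfl | hz, hz'⟩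
        · exact absurd hy hz'
        · exact ⟨hz.2, hz'⟩
    have hmem := hR _ _ hxy _ (ih _ hlt _ hinj (himg ▸ hP') rfl)
    rw [act_single_word, Finset.sum_eq_single j] at hmem
    · simpa using hmem
    · intro k _ hk
      rw [Function.update_of_ne hk, if_neg (hyγ' k)]
    · simp

/-- The sign of a word in eight letters (zero if a letter occurs twice). -/
def wordSign (c : Fin 8 → Fin 8) : ℤ :=
  ∏ i, ∏ j ∈ Finset.Ioi i, if c i = c j then 0 else if c i < c j then 1 else -1

theorem det_word {K : Type*} [Field K] (c : Fin 8 → Fin 8) :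
    Matrix.det (fun i => Pi.single (c i) 1 : Fin 8 → Fin 8 → K) = (wordSign c : K) := by
  by_cases hc : Function.Injective c
  · have hm : (fun i => Pi.single (c i) 1 : Fin 8 → Fin 8 → K) =
        Equiv.Perm.permMatrix K (Equiv.ofBijective c (Finite.injective_iff_bijective.1 hc)) := by
      funext i j
      simp [Equiv.Perm.permMatrix, PEquiv.toMatrix_apply, Pi.single_apply, eq_comm]
    rw [hm, Matrix.det_permutation, Equiv.Perm.sign_eq_prod_prod_Ioi, wordSign]
    congr 1
    push_cast
    refine Finset.prod_congr rfl fun i _ => Finset.prod_congr rfl fun j hj => ?_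
    have : c i ≠ c j := fun h => (Finset.mem_Ioi.1 hj).ne (hc h)
    simp only [Equiv.ofBijective_apply, if_neg this]
    split_ifs <;> rfl
  · have : ∃ i j, i < j ∧ c i = c j := by
      simp only [Function.Injective, not_forall] at hc
      obtain ⟨i, j, h, hij⟩ := hc
      rcases lt_or_gt_of_ne hij with h' | h'
      · exact ⟨i, j, h', h⟩
      · exact ⟨j, i, h', h.symm⟩
    obtain ⟨i, j, hij, h⟩ := this
    have h0 : wordSign c = 0 := Finset.prod_eq_zero (Finset.mem_univ i)
      (Finset.prod_eq_zero (Finset.mem_Ioi.2 hij) (if_pos h))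
    rw [h0, Int.cast_zero]
    exact Matrix.det_zero_of_row_eq hij.ne (by simp only [h])

theorem pairing_word {K : Type*} [Field K] (α β : Fin 4 → Fin 8) :
    pairing K (word K α) (word K β) = (wordSign (Fin.append α β) : K) := by
  rw [word, word, pairing_ιMulti, ← det_word]
  congr 1
  funext i
  refine Fin.addCases (m := 4) (n := 4) (fun i => ?_) (fun i => ?_) i
  · rw [Fin.append_left, Fin.append_left]
  · rw [Fin.append_right, Fin.append_right]

/-- Coefficients of the moment matrix of two words. -/
def momentCoeff (α β : Fin 4 → Fin 8) (i j : Fin 8) : ℤ :=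
  ∑ k, if α k = i then wordSign (Fin.append (Function.update α k j) β) else 0

theorem moment_word {K : Type*} [Field K] (α β : Fin 4 → Fin 8) (C : Fin 8 → Fin 8 → ℤ)
    (h : ∀ i j, momentCoeff α β i j = C i j) :
    moment K (word K α) (word K β) = Matrix.of fun i j => (C i j : K) := by
  ext i j
  rw [moment_apply, act_single_word, map_sum, LinearMap.sum_apply, Matrix.of_apply, ← h,
    momentCoeff]
  push_cast
  refine Finset.sum_congr rfl fun k _ => ?_
  split_ifs
  · rw [pairing_word]
  · simp

theorem moment_word_zero {K : Type*} [Field K] (α β : Fin 4 → Fin 8)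
    (h : ∀ i j, momentCoeff α β i j = 0) : moment K (word K α) (word K β) = 0 := by
  rw [moment_word α β _ h]
  ext i j
  simp

theorem moment_word_single {K : Type*} [Field K] (α β : Fin 4 → Fin 8) (x y : Fin 8) (c : ℤ)
    (h : ∀ i j, momentCoeff α β i j = if i = x ∧ j = y then c else 0) :
    moment K (word K α) (word K β) = (c : K) • Matrix.single x y 1 := by
  rw [moment_word α β _ h]
  ext i j
  rw [Matrix.of_apply, Matrix.smul_apply, Matrix.single_apply]
  by_cases hij : i = x ∧ j = y
  · rw [if_pos hij, if_pos ⟨hij.1.symm, hij.2.symm⟩]; simp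
  · rw [if_neg hij, if_neg (fun h => hij ⟨h.1.symm, h.2.symm⟩)]; simp

theorem act_moment_diag {K : Type*} [Field K] (γ : Fin 4 → Fin 8) :
    act K (moment K (word K ![0, 1, 2, 3]) (word K ![4, 5, 6, 7])) (word K γ) =
      (((∑ k, if γ k < 4 then 1 else 0 : ℤ)) : K) • word K γ := by
  have hm : moment K (word K ![0, 1, 2, 3]) (word K ![4, 5, 6, 7]) =
      ∑ x : Fin 8, (if x < 4 then (1 : K) else 0) • Matrix.single x x 1 := by
    rw [moment_word _ _ (fun i j => if i = j ∧ i < 4 then 1 else 0) (by decide +kernel)]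
    ext i j
    rw [Matrix.sum_apply, Matrix.of_apply, Finset.sum_eq_single i]
    · rw [Matrix.smul_apply, Matrix.single_apply]
      by_cases h1 : i = j <;> by_cases h2 : i < 4 <;> simp [h1, h2]
    · intro x _ hx
      rw [Matrix.smul_apply, Matrix.single_apply, if_neg (fun h' : x = i ∧ x = j => hx h'.1), smul_zero]
    · simp
  rw [hm, map_sum, LinearMap.sum_apply]
  simp only [map_smul, LinearMap.smul_apply, act_single_word, Finset.smul_sum]
  rw [Finset.sum_comm]
  push_cast
  rw [Finset.sum_smul]
  refine Finset.sum_congr rfl fun k _ => ?_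
  rw [Finset.sum_eq_single (γ k)]
  · rw [if_pos rfl, Function.update_eq_self]
  · intro x _ hx
    rw [if_neg (Ne.symm hx), smul_zero]
  · simp

/-- The cyclic sum whose vanishing is the Jacobi identity for three elements of `⋀⁴ K⁸`. -/
def jac {K : Type*} [Field K] (u v w : ⋀[K]^4 (Fin 8 → K)) : ⋀[K]^4 (Fin 8 → K) :=
  act K (moment K u v) w + act K (moment K v w) u + act K (moment K w u) v -
    (2 : K) • (pairing K u v • w + pairing K v w • u + pairing K w u • v)

theorem jac_cyc {K : Type*} [Field K] (u v w : ⋀[K]^4 (Fin 8 → K)) : jac u v w = jac v w u := by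
  simp only [jac]; module

theorem jac_add {K : Type*} [Field K] (u v w w' : ⋀[K]^4 (Fin 8 → K)) :
    jac u v (w + w') = jac u v w + jac u v w' := by
  simp only [jac, map_add, LinearMap.add_apply]; module

theorem jac_smul {K : Type*} [Field K] (c : K) (u v w : ⋀[K]^4 (Fin 8 → K)) :
    jac u v (c • w) = c • jac u v w := by
  simp only [jac, map_smul, LinearMap.smul_apply, smul_eq_mul]; module

theorem jac_zero {K : Type*} [Field K] (u v : ⋀[K]^4 (Fin 8 → K)) : jac u v 0 = 0 := by
  simpa using jac_smul 0 u v 0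

theorem jac_swap {K : Type*} [Field K] (u v w : ⋀[K]^4 (Fin 8 → K)) :
    jac u v w = - jac v u w := by
  have h : ∀ u v w : ⋀[K]^4 (Fin 8 → K), act K (moment K u v) w =
      (4 * pairing K u v) • w - act K (moment K v u) w := by
    intro u v w
    rw [eq_sub_of_add_eq (moment_add_moment u v), map_sub, LinearMap.sub_apply, map_smul,
      LinearMap.smul_apply, act_one, smul_smul, mul_comm]
  simp only [jac]
  rw [h u v w, h v w u, h w u v, pairing_comm v u, pairing_comm u w, pairing_comm w v]
  module

theorem jac_self {K : Type*} [Field K] [CharZero K] (u w : ⋀[K]^4 (Fin 8 → K)) :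
    jac u u w = 0 := by
  have h := jac_swap u u w
  have h2 : (2 : K) • jac u u w = 0 := by
    rw [two_smul]; nth_rewrite 1 [h]; exact neg_add_cancel _
  exact (smul_eq_zero.1 h2).resolve_left two_ne_zero

theorem jac_act {K : Type*} [Field K] (A : Matrix (Fin 8) (Fin 8) K) (hA : A.trace = 0)
    (u v w : ⋀[K]^4 (Fin 8 → K)) :
    jac (act K A u) v w + jac u (act K A v) w + jac u v (act K A w) = act K A (jac u v w) := by
  have h : ∀ u v w : ⋀[K]^4 (Fin 8 → K), act K A (act K (moment K u v) w) =
      act K (moment K (act K A u) v) w + act K (moment K u (act K A v)) w +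
        act K (moment K u v) (act K A w) := by
    intro u v w
    rw [← LinearMap.add_apply, ← map_add, moment_act, hA, zero_smul, add_zero, act_commutator]
    abel
  have hp : ∀ u v : ⋀[K]^4 (Fin 8 → K),
      pairing K u (act K A v) = - pairing K (act K A u) v := by
    intro u v
    have := pairing_act A u v
    rw [hA, zero_mul] at this
    linear_combination this
  have e : act K A (jac u v w) = act K A (act K (moment K u v) w) +
      act K A (act K (moment K v w) u) + act K A (act K (moment K w u) v) -
      (2 : K) • (pairing K u v • act K A w + pairing K v w • act K A u +
        pairing K w u • act K A v) := by
    simp only [jac, LinearMap.map_sub, LinearMap.map_add, LinearMap.map_smul]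
  rw [e, h u v w, h v w u, h w u v]
  simp only [jac, hp]
  module

theorem jac_base {K : Type*} [Field K] [CharZero K] (w : ⋀[K]^4 (Fin 8 → K)) :
    jac (word K ![0, 1, 2, 3]) (word K ![4, 5, 6, 7]) w = 0 := by
  set a := word K ![0, 1, 2, 3]
  set b := word K ![4, 5, 6, 7]
  let N : Submodule K (⋀[K]^4 (Fin 8 → K)) :=
    { carrier := {w | jac a b w = 0}
      add_mem' := fun {x y} hx hy => by
        simp only [Set.mem_ofPred_eq] at *; rw [jac_add, hx, hy, add_zero]
      zero_mem' := jac_zero _ _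
      smul_mem' := fun c x hx => by
        simp only [Set.mem_ofPred_eq] at *; rw [jac_smul, hx, smul_zero] }
  have hE : ∀ x y : Fin 8, x ≠ y ∧ (x < 4 ↔ y < 4) → ∀ u ∈ N,
      act K (Matrix.single x y 1) u ∈ N := by
    rintro x y hxy u hu
    have ha : act K (Matrix.single x y 1) a = 0 := by
      rw [act_single_word]
      refine Finset.sum_eq_zero fun k _ => ?_
      split_ifs with h
      · exact word_eq_zero ((by decide : ∀ x y : Fin 8, x ≠ y ∧ (x < 4 ↔ y < 4) → ∀ k,
          (![0, 1, 2, 3] : Fin 4 → Fin 8) k = y →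
          ¬ Function.Injective (Function.update (![0, 1, 2, 3] : Fin 4 → Fin 8) k x))
          x y hxy k h)
      · rfl
    have hb : act K (Matrix.single x y 1) b = 0 := by
      rw [act_single_word]
      refine Finset.sum_eq_zero fun k _ => ?_
      split_ifs with h
      · exact word_eq_zero ((by decide : ∀ x y : Fin 8, x ≠ y ∧ (x < 4 ↔ y < 4) → ∀ k,
          (![4, 5, 6, 7] : Fin 4 → Fin 8) k = y →
          ¬ Function.Injective (Function.update (![4, 5, 6, 7] : Fin 4 → Fin 8) k x))
          x y hxy k h)
      · rfl
    have h := jac_act (Matrix.single x y (1 : K)) (Matrix.trace_single_eq_of_ne _ _ _ hxy.1) a b u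
    rw [ha, hb, show jac a b u = 0 from hu, map_zero, jac_cyc, jac_zero,
      ← jac_cyc, jac_zero, zero_add, zero_add] at h
    exact h
  have hpab : pairing K a b = 1 := by
    rw [pairing_word, show wordSign _ = 1 by decide +kernel]; simp
  have h0 : word K ![4, 5, 6, 7] ∈ N := by
    change jac a b b = 0
    rw [jac_cyc, jac_self]
  have h1 : word K ![4, 5, 6, 0] ∈ N := by
    change jac a b (word K ![4, 5, 6, 0]) = 0
    have e : act K (Matrix.single 0 7 1) b = word K ![4, 5, 6, 0] := by
      have hk : ∀ k, k ≠ 3 → (![4, 5, 6, 7] : Fin 4 → Fin 8) k ≠ 7 := by decide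
      have hu : Function.update (![4, 5, 6, 7] : Fin 4 → Fin 8) 3 0 = ![4, 5, 6, 0] := by decide
      rw [act_single_word, Finset.sum_eq_single 3, if_pos (by decide), hu]
      · intro k _ hk'
        rw [if_neg (hk k hk')]
      · simp
    rw [jac, act_moment_diag, hpab,
      moment_word_zero ![4, 5, 6, 7] ![4, 5, 6, 0] (by decide +kernel),
      moment_word_single ![4, 5, 6, 0] ![0, 1, 2, 3] 0 7 1 (by decide +kernel),
      pairing_word ![4, 5, 6, 7] ![4, 5, 6, 0], pairing_word ![4, 5, 6, 0] ![0, 1, 2, 3],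
      show wordSign (Fin.append ![4, 5, 6, 7] ![4, 5, 6, 0]) = 0 by decide +kernel,
      show wordSign (Fin.append ![4, 5, 6, 0] ![0, 1, 2, 3]) = 0 by decide +kernel,
      show (∑ k, if (![4, 5, 6, 0] : Fin 4 → Fin 8) k < 4 then 1 else 0 : ℤ) = 1 by decide]
    simp only [map_smul, LinearMap.smul_apply, map_zero, LinearMap.zero_apply, e, Int.cast_zero,
      Int.cast_one]
    module
  have h2 : word K ![0, 1, 4, 5] ∈ N := by
    change jac a b (word K ![0, 1, 4, 5]) = 0
    rw [jac, act_moment_diag, hpab,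
      moment_word_zero ![4, 5, 6, 7] ![0, 1, 4, 5] (by decide +kernel),
      moment_word_zero ![0, 1, 4, 5] ![0, 1, 2, 3] (by decide +kernel),
      pairing_word ![4, 5, 6, 7] ![0, 1, 4, 5], pairing_word ![0, 1, 4, 5] ![0, 1, 2, 3],
      show wordSign (Fin.append ![4, 5, 6, 7] ![0, 1, 4, 5]) = 0 by decide +kernel,
      show wordSign (Fin.append ![0, 1, 4, 5] ![0, 1, 2, 3]) = 0 by decide +kernel,
      show (∑ k, if (![0, 1, 4, 5] : Fin 4 → Fin 8) k < 4 then 1 else 0 : ℤ) = 2 by decide]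
    simp only [map_zero, LinearMap.zero_apply, Int.cast_zero, Int.cast_ofNat]
    module
  have h3 : word K ![0, 1, 2, 4] ∈ N := by
    change jac a b (word K ![0, 1, 2, 4]) = 0
    have e : act K (Matrix.single 4 3 1) a = word K ![0, 1, 2, 4] := by
      have hk : ∀ k, k ≠ 3 → (![0, 1, 2, 3] : Fin 4 → Fin 8) k ≠ 3 := by decide
      have hu : Function.update (![0, 1, 2, 3] : Fin 4 → Fin 8) 3 4 = ![0, 1, 2, 4] := by decide
      rw [act_single_word, Finset.sum_eq_single 3, if_pos (by decide), hu]
      · intro k _ hk'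
        rw [if_neg (hk k hk')]
      · simp
    rw [jac, act_moment_diag, hpab,
      moment_word_single ![4, 5, 6, 7] ![0, 1, 2, 4] 4 3 (-1) (by decide +kernel),
      moment_word_zero ![0, 1, 2, 4] ![0, 1, 2, 3] (by decide +kernel),
      pairing_word ![4, 5, 6, 7] ![0, 1, 2, 4], pairing_word ![0, 1, 2, 4] ![0, 1, 2, 3],
      show wordSign (Fin.append ![4, 5, 6, 7] ![0, 1, 2, 4]) = 0 by decide +kernel,
      show wordSign (Fin.append ![0, 1, 2, 4] ![0, 1, 2, 3]) = 0 by decide +kernel,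
      show (∑ k, if (![0, 1, 2, 4] : Fin 4 → Fin 8) k < 4 then 1 else 0 : ℤ) = 3 by decide]
    simp only [map_smul, LinearMap.smul_apply, map_zero, LinearMap.zero_apply, e, Int.cast_zero,
      Int.cast_one, Int.cast_neg, Int.cast_ofNat]
    module
  have h4 : word K ![0, 1, 2, 3] ∈ N := by
    change jac a b a = 0
    rw [jac_cyc, jac_cyc, jac_self]
  have key : ∀ α : Fin 4 → Fin 8, word K α ∈ N →
      (∀ s : Finset (Fin 8), s.card = 4 →
        (s.filter (· < 4)).card = ((Finset.univ.image α).filter (· < 4)).card →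
        s ≠ Finset.univ.image α → ∃ x ∈ s, ∃ y ∈ Finset.univ.image α,
          x ∉ Finset.univ.image α ∧ y ∉ s ∧
          ((insert y (s.erase x)).filter (· < 4)).card =
            ((Finset.univ.image α).filter (· < 4)).card ∧
          (x ≠ y ∧ (x < 4 ↔ y < 4))) →
      ∀ γ : Fin 4 → Fin 8, Function.Injective γ →
        ((Finset.univ.image γ).filter (· < 4)).card =
          ((Finset.univ.image α).filter (· < 4)).card → word K γ ∈ N :=
    fun α hα hP γ hγ hc => mem_of_exchange N α hα
      (fun s => (s.filter (· < 4)).card = ((Finset.univ.image α).filter (· < 4)).card)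
      (fun x y => x ≠ y ∧ (x < 4 ↔ y < 4)) hE hP γ hγ hc
  refine span_words N (fun γ hγ => ?_) w
  have hle : ((Finset.univ.image γ).filter (· < 4)).card ≤ 4 :=
    (Finset.card_filter_le _ _).trans
      (by rw [Finset.card_image_of_injective _ hγ]; simp)
  have hcases : ∀ n, n ≤ 4 → n = 0 ∨ n = 1 ∨ n = 2 ∨ n = 3 ∨ n = 4 := by omega
  rcases hcases _ hle with h | h | h | h | h
  · exact key _ h0 (by decide +kernel) γ hγ (h.trans (by decide))
  · exact key _ h1 (by decide +kernel) γ hγ (h.trans (by decide))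
  · exact key _ h2 (by decide +kernel) γ hγ (h.trans (by decide))
  · exact key _ h3 (by decide +kernel) γ hγ (h.trans (by decide))
  · exact key _ h4 (by decide +kernel) γ hγ (h.trans (by decide))

theorem jac_eq_zero {K : Type*} [Field K] [CharZero K] (u v w : ⋀[K]^4 (Fin 8 → K)) :
    jac u v w = 0 := by
  set a := word K ![0, 1, 2, 3] with ha
  let N₂ : Submodule K (⋀[K]^4 (Fin 8 → K)) :=
    { carrier := {v | ∀ w, jac w a v = 0}
      add_mem' := fun {x y} hx hy w => by rw [jac_add, hx w, hy w, add_zero]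
      zero_mem' := fun w => jac_zero _ _
      smul_mem' := fun c x hx w => by rw [jac_smul, hx w, smul_zero] }
  have h₂ : ∀ v, v ∈ N₂ := by
    refine span_words N₂ fun γ hγ => mem_of_exchange N₂ ![4, 5, 6, 7] ?_ (fun _ => True)
      (fun x y => x < 4 ∧ 4 ≤ y) ?_ (by decide +kernel) γ hγ trivial
    · intro w
      rw [jac_cyc, jac_base]
    · intro x y hxy v hv w
      have hE : act K (Matrix.single x y 1) a = 0 := by
        rw [act_single_word]
        refine Finset.sum_eq_zero fun k _ => if_neg ?_
        exact (by decide : ∀ x y : Fin 8, x < 4 ∧ 4 ≤ y → ∀ k,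
          (![0, 1, 2, 3] : Fin 4 → Fin 8) k ≠ y) x y hxy k
      have h := jac_act (Matrix.single x y (1 : K))
        (Matrix.trace_single_eq_of_ne _ _ _ (hxy.1.trans_le hxy.2).ne) w a v
      rw [hE, hv w, map_zero, hv, jac_cyc w 0, jac_cyc 0 v, jac_zero, zero_add, zero_add] at h
      exact h
  let N₁ : Submodule K (⋀[K]^4 (Fin 8 → K)) :=
    { carrier := {u | ∀ v w, jac v w u = 0}
      add_mem' := fun {x y} hx hy v w => by rw [jac_add, hx v w, hy v w, add_zero]
      zero_mem' := fun v w => jac_zero _ _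
      smul_mem' := fun c x hx v w => by rw [jac_smul, hx v w, smul_zero] }
  have h₁ : ∀ u, u ∈ N₁ := by
    refine span_words N₁ fun γ hγ => mem_of_exchange N₁ ![0, 1, 2, 3] ?_ (fun _ => True)
      (fun x y => x ≠ y) ?_ (by decide +kernel) γ hγ trivial
    · intro v w
      rw [jac_cyc]
      exact h₂ v w
    · intro x y hxy u hu v w
      have h := jac_act (Matrix.single x y (1 : K))
        (Matrix.trace_single_eq_of_ne _ _ _ hxy) v w u
      rw [hu v w, hu, hu, map_zero, zero_add, zero_add] at h
      exact h
  exact h₁ w u v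

/-- The traceless part of the moment matrix: the element `μ` of `𝔰𝔩₈` determined by
`tr (μ * A) = vol ((A · u) ∧ v)` for all traceless matrices `A`. -/
def momentSl (K : Type*) [Field K] [CharZero K] (u v : ⋀[K]^4 (Fin 8 → K)) :
    LieAlgebra.SpecialLinear.sl (Fin 8) K :=
  ⟨moment K u v - ((moment K u v).trace / 8) • 1, by
    refine LinearMap.mem_ker.2 ?_
    simp only [Matrix.traceLinearMap_apply, Matrix.trace_sub, Matrix.trace_smul, Matrix.trace_one,
      Fintype.card_fin, smul_eq_mul]
    push_cast
    ring⟩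

theorem coe_momentSl {K : Type*} [Field K] [CharZero K] (u v : ⋀[K]^4 (Fin 8 → K)) :
    (momentSl K u v : Matrix (Fin 8) (Fin 8) K) =
      moment K u v - (2⁻¹ * pairing K u v) • (1 : Matrix (Fin 8) (Fin 8) K) := by
  have h : (moment K u v).trace / 8 = 2⁻¹ * pairing K u v := by
    rw [trace_moment]; ring
  rw [← h]
  rfl

theorem momentSl_add_left {K : Type*} [Field K] [CharZero K] (u u' v : ⋀[K]^4 (Fin 8 → K)) :
    (momentSl K (u + u') v : Matrix (Fin 8) (Fin 8) K) = momentSl K u v + momentSl K u' v := by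
  simp only [coe_momentSl, map_add, LinearMap.add_apply]
  module

theorem momentSl_smul_left {K : Type*} [Field K] [CharZero K] (c : K)
    (u v : ⋀[K]^4 (Fin 8 → K)) :
    (momentSl K (c • u) v : Matrix (Fin 8) (Fin 8) K) = c • momentSl K u v := by
  simp only [coe_momentSl, map_smul, LinearMap.smul_apply, smul_eq_mul]
  module

theorem momentSl_swap {K : Type*} [Field K] [CharZero K] (u v : ⋀[K]^4 (Fin 8 → K)) :
    (momentSl K u v : Matrix (Fin 8) (Fin 8) K) = - momentSl K v u := by
  rw [coe_momentSl, coe_momentSl, eq_sub_of_add_eq (moment_add_moment u v), pairing_comm v u]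
  module

theorem momentSl_self {K : Type*} [Field K] [CharZero K] (u : ⋀[K]^4 (Fin 8 → K)) :
    (momentSl K u u : Matrix (Fin 8) (Fin 8) K) = 0 := by
  have h : (2 : K) • (momentSl K u u : Matrix (Fin 8) (Fin 8) K) = 0 := by
    rw [two_smul]; nth_rewrite 1 [momentSl_swap]; exact neg_add_cancel _
  exact (smul_eq_zero.1 h).resolve_left two_ne_zero

theorem momentSl_act {K : Type*} [Field K] [CharZero K] (A : Matrix (Fin 8) (Fin 8) K)
    (hA : A.trace = 0) (u v : ⋀[K]^4 (Fin 8 → K)) :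
    A * momentSl K u v = momentSl K u v * A +
      (momentSl K (act K A u) v - momentSl K (act K A v) u) := by
  have h := moment_act A u v
  have h' := pairing_act A u v
  rw [hA, zero_smul, add_zero] at h
  rw [hA, zero_mul] at h'
  rw [momentSl_swap (act K A v) u, sub_neg_eq_add, coe_momentSl, coe_momentSl, coe_momentSl,
    mul_sub, sub_mul, Matrix.mul_smul, Matrix.smul_mul, mul_one, one_mul,
    eq_neg_of_add_eq_zero_left h', eq_sub_of_add_eq h]
  module

theorem act_momentSl {K : Type*} [Field K] [CharZero K] (u v w : ⋀[K]^4 (Fin 8 → K)) :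
    act K (momentSl K u v : Matrix (Fin 8) (Fin 8) K) w =
      act K (moment K u v) w - (2 : K) • pairing K u v • w := by
  rw [coe_momentSl, map_sub, map_smul, LinearMap.sub_apply, LinearMap.smul_apply, act_one,
    smul_smul, smul_smul]
  congr 2
  ring

theorem act_momentSl_cyclic {K : Type*} [Field K] [CharZero K] (u v w : ⋀[K]^4 (Fin 8 → K)) :
    act K (momentSl K u v : Matrix (Fin 8) (Fin 8) K) w +
      act K (momentSl K v w : Matrix (Fin 8) (Fin 8) K) u =
      act K (momentSl K u w : Matrix (Fin 8) (Fin 8) K) v := by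
  have h := jac_eq_zero u v w
  rw [jac] at h
  have e : act K (momentSl K u w : Matrix (Fin 8) (Fin 8) K) v =
      - act K (momentSl K w u : Matrix (Fin 8) (Fin 8) K) v := by
    rw [momentSl_swap, map_neg, LinearMap.neg_apply]
  have e1 := act_momentSl u v w
  have e2 := act_momentSl v w u
  have e3 := act_momentSl w u v
  generalize act K (momentSl K u v : Matrix (Fin 8) (Fin 8) K) w = x1 at *
  generalize act K (momentSl K v w : Matrix (Fin 8) (Fin 8) K) u = x2 at *
  generalize act K (momentSl K w u : Matrix (Fin 8) (Fin 8) K) v = x3 at *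
  rw [e, e1, e2, e3, ← sub_eq_zero, ← h]
  module

/-- The split simple Lie algebra of type `E₇` over `K`, as the sum of `𝔰𝔩₈` and `⋀⁴ K⁸`, with the
bracket `⁅A + u, B + v⁆ = ([A, B] + μ(u, v)) + (A · v - B · u)` given below.
With `E_ij` the matrix units and `e_ijkl = v_i ∧ v_j ∧ v_k ∧ v_l`, canonical generators are
`e₁ = E₂₃`, `e₂ = e₅₆₇₈`, `e₃ = E₃₄`, `e₄ = E₄₅`, `e₅ = E₅₆`, `e₆ = E₆₇`, `e₇ = E₇₈` and
`f₁ = E₃₂`, `f₂ = e₁₂₃₄`, `f₃ = E₄₃`, …, `f₇ = E₈₇` (Bourbaki numbering), and `E₁₂`, `E₂₁` are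
root vectors for the lowest root and its negative. The `E_ij` with `i ≠ j` and the `e_ijkl` are, up to
signs, the root vectors of a Chevalley basis; so `E7 ℝ` is the real span in `E7 ℂ` of a Chevalley
basis. -/
def E7 (K : Type*) [Field K] : Type _ :=
  LieAlgebra.SpecialLinear.sl (Fin 8) K × ⋀[K]^4 (Fin 8 → K)

instance (K : Type*) [Field K] : AddCommGroup (E7 K) :=
  inferInstanceAs (AddCommGroup (LieAlgebra.SpecialLinear.sl (Fin 8) K × ⋀[K]^4 (Fin 8 → K)))

instance (K : Type*) [Field K] : Module K (E7 K) :=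
  inferInstanceAs (Module K (LieAlgebra.SpecialLinear.sl (Fin 8) K × ⋀[K]^4 (Fin 8 → K)))

namespace E7

/-- The component in `𝔰𝔩₈`, as a linear map. -/
def toSl (K : Type*) [Field K] : E7 K →ₗ[K] LieAlgebra.SpecialLinear.sl (Fin 8) K :=
  LinearMap.fst K _ _

/-- The component in `⋀⁴ K⁸`, as a linear map. -/
def toForm (K : Type*) [Field K] : E7 K →ₗ[K] ⋀[K]^4 (Fin 8 → K) :=
  LinearMap.snd K _ _

/-- The element with the given components. -/
def mk {K : Type*} [Field K] (A : LieAlgebra.SpecialLinear.sl (Fin 8) K)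
    (u : ⋀[K]^4 (Fin 8 → K)) : E7 K := (A, u)

@[simp]
theorem toSl_mk {K : Type*} [Field K] (A : LieAlgebra.SpecialLinear.sl (Fin 8) K)
    (u : ⋀[K]^4 (Fin 8 → K)) : toSl K (mk A u) = A := rfl

@[simp]
theorem toForm_mk {K : Type*} [Field K] (A : LieAlgebra.SpecialLinear.sl (Fin 8) K)
    (u : ⋀[K]^4 (Fin 8 → K)) : toForm K (mk A u) = u := rfl

theorem ext {K : Type*} [Field K] {x y : E7 K}
    (h₀ : (toSl K x : Matrix (Fin 8) (Fin 8) K) = toSl K y) (h₁ : toForm K x = toForm K y) :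
    x = y :=
  Prod.ext (Subtype.ext h₀) h₁

/-- `⁅A + u, B + v⁆ = ([A, B] + μ(u, v)) + (A · v - B · u)`. -/
instance (K : Type*) [Field K] [CharZero K] : Bracket (E7 K) (E7 K) where
  bracket x y := mk (⁅toSl K x, toSl K y⁆ + momentSl K (toForm K x) (toForm K y))
    (act K (toSl K x : Matrix (Fin 8) (Fin 8) K) (toForm K y) -
      act K (toSl K y : Matrix (Fin 8) (Fin 8) K) (toForm K x))

theorem toSl_lie {K : Type*} [Field K] [CharZero K] (x y : E7 K) :
    (toSl K ⁅x, y⁆ : Matrix (Fin 8) (Fin 8) K) =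
      (toSl K x : Matrix (Fin 8) (Fin 8) K) * toSl K y -
      (toSl K y : Matrix (Fin 8) (Fin 8) K) * toSl K x + momentSl K (toForm K x) (toForm K y) := rfl

theorem toForm_lie {K : Type*} [Field K] [CharZero K] (x y : E7 K) :
    toForm K ⁅x, y⁆ = act K (toSl K x : Matrix (Fin 8) (Fin 8) K) (toForm K y) -
      act K (toSl K y : Matrix (Fin 8) (Fin 8) K) (toForm K x) := rfl

theorem act_toSl_lie {K : Type*} [Field K] [CharZero K] (x y : E7 K) (w : ⋀[K]^4 (Fin 8 → K)) :
    act K (toSl K ⁅x, y⁆ : Matrix (Fin 8) (Fin 8) K) w =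
      act K (toSl K x : Matrix (Fin 8) (Fin 8) K) (act K (toSl K y : Matrix _ _ K) w) -
      act K (toSl K y : Matrix (Fin 8) (Fin 8) K) (act K (toSl K x : Matrix _ _ K) w) +
      act K (momentSl K (toForm K x) (toForm K y) : Matrix (Fin 8) (Fin 8) K) w := by
  rw [toSl_lie, map_add, LinearMap.add_apply, act_commutator]

theorem trace_toSl {K : Type*} [Field K] (x : E7 K) :
    (toSl K x : Matrix (Fin 8) (Fin 8) K).trace = 0 :=
  LinearMap.mem_ker.1 (toSl K x).2

theorem coe_add {K : Type*} [Field K] (A B : LieAlgebra.SpecialLinear.sl (Fin 8) K) :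
    ((A + B : LieAlgebra.SpecialLinear.sl (Fin 8) K) : Matrix (Fin 8) (Fin 8) K) = A + B := rfl

theorem coe_neg {K : Type*} [Field K] (A : LieAlgebra.SpecialLinear.sl (Fin 8) K) :
    ((-A : LieAlgebra.SpecialLinear.sl (Fin 8) K) : Matrix (Fin 8) (Fin 8) K) = -A := rfl

theorem coe_smul {K : Type*} [Field K] (c : K) (A : LieAlgebra.SpecialLinear.sl (Fin 8) K) :
    ((c • A : LieAlgebra.SpecialLinear.sl (Fin 8) K) : Matrix (Fin 8) (Fin 8) K) = c • A := rfl

theorem add_lie' {K : Type*} [Field K] [CharZero K] (x y z : E7 K) :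
    ⁅x + y, z⁆ = ⁅x, z⁆ + ⁅y, z⁆ := by
  apply ext
  · rw [map_add, coe_add, toSl_lie, toSl_lie, toSl_lie, map_add, coe_add, map_add,
      momentSl_add_left, add_mul, mul_add]
    abel
  · rw [map_add, toForm_lie, toForm_lie, toForm_lie, map_add, map_add, coe_add, map_add, map_add,
      LinearMap.add_apply]
    abel

theorem lie_swap' {K : Type*} [Field K] [CharZero K] (x y : E7 K) : ⁅x, y⁆ = -⁅y, x⁆ := by
  apply ext
  · rw [map_neg, coe_neg, toSl_lie, toSl_lie, momentSl_swap]
    abel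
  · rw [map_neg, toForm_lie, toForm_lie]
    abel

theorem smul_lie' {K : Type*} [Field K] [CharZero K] (c : K) (x y : E7 K) :
    ⁅c • x, y⁆ = c • ⁅x, y⁆ := by
  apply ext
  · rw [map_smul, coe_smul, toSl_lie, toSl_lie, map_smul, coe_smul, map_smul, momentSl_smul_left,
      Matrix.smul_mul, Matrix.mul_smul, smul_add, smul_sub]
  · rw [map_smul, toForm_lie, toForm_lie, map_smul, map_smul, coe_smul, map_smul, map_smul,
      LinearMap.smul_apply, smul_sub]

theorem leibniz_aux {K E V : Type*} [Field K] [AddCommGroup V] [Module K V]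
    (P : E → Module.End K V) (b : E → E → E) (t : E → V) (Q : E → E → V → V)
    (ht : ∀ x y, t (b x y) = P x (t y) - P y (t x))
    (hP : ∀ x y w, P (b x y) w = P x (P y w) - P y (P x w) + Q x y w) (x y z : E)
    (hQ : Q x y (t z) + Q y z (t x) = Q x z (t y)) :
    t (b x (b y z)) = t (b (b x y) z) + t (b y (b x z)) := by
  rw [ht x, ht (b x y), ht y (b x z), hP, hP, hP, ht y z, ht x y, ht x z, ← hQ]
  simp only [map_sub]
  abel

theorem leibniz' {K : Type*} [Field K] [CharZero K] (x y z : E7 K) :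
    ⁅x, ⁅y, z⁆⁆ = ⁅⁅x, y⁆, z⁆ + ⁅y, ⁅x, z⁆⁆ := by
  have hsub : ∀ u u' v : ⋀[K]^4 (Fin 8 → K),
      (momentSl K (u - u') v : Matrix (Fin 8) (Fin 8) K) = momentSl K u v - momentSl K u' v := by
    intro u u' v
    have h := momentSl_add_left (u - u') u' v
    rw [sub_add_cancel] at h
    exact eq_sub_of_add_eq h.symm
  apply ext
  · have h1 := momentSl_act _ (trace_toSl x) (toForm K y) (toForm K z)
    have h2 := momentSl_act _ (trace_toSl y) (toForm K x) (toForm K z)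
    have h3 := momentSl_act _ (trace_toSl z) (toForm K x) (toForm K y)
    rw [map_add, coe_add, toSl_lie x ⁅y, z⁆, toSl_lie ⁅x, y⁆ z, toSl_lie y ⁅x, z⁆, toForm_lie y z,
      toForm_lie x y, toForm_lie x z, toSl_lie y z, toSl_lie x y, toSl_lie x z, momentSl_swap (toForm K x) (_ - _),
      momentSl_swap (toForm K y) (_ - _), hsub, hsub, hsub, mul_add, mul_add, mul_add, h1, h2, h3]
    simp only [mul_sub, sub_mul, add_mul, mul_assoc]
    abel
  · exact (leibniz_aux (fun x : E7 K => act K (toSl K x : Matrix (Fin 8) (Fin 8) K))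
      (fun x y : E7 K => ⁅x, y⁆) (toForm K)
      (fun x y w => act K (momentSl K (toForm K x) (toForm K y) : Matrix (Fin 8) (Fin 8) K) w)
      toForm_lie act_toSl_lie x y z (act_momentSl_cyclic _ _ _)).trans
      (map_add (toForm K) _ _).symm

instance (K : Type*) [Field K] [CharZero K] : LieRing (E7 K) where
  add_lie := add_lie'
  lie_add x y z := by
    rw [lie_swap', add_lie', neg_add, ← lie_swap', ← lie_swap']
  lie_self x := by
    apply ext
    · rw [toSl_lie, sub_self, zero_add, map_zero, momentSl_self]
      rfl
    · rw [toForm_lie, sub_self, map_zero]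
  leibniz_lie := leibniz'

instance (K : Type*) [Field K] [CharZero K] : LieAlgebra K (E7 K) where
  lie_smul c x y := by
    rw [lie_swap', smul_lie', lie_swap' y x, smul_neg, neg_neg]

end E7

namespace E7

/-- The involution `θ`, with `θ (A + u) = A - u`. -/
def theta (K : Type*) [Field K] [CharZero K] : E7 K ≃ₗ⁅K⁆ E7 K where
  toFun x := mk (toSl K x) (-toForm K x)
  invFun x := mk (toSl K x) (-toForm K x)
  map_add' x y := by
    apply ext
    · rfl
    · simp only [toForm_mk, map_add]; abel
  map_smul' c x := by
    apply ext
    · rfl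
    · simp only [toForm_mk, map_smul, RingHom.id_apply, smul_neg]
  map_lie' {x y} := by
    apply ext
    · rw [toSl_mk, toSl_lie, toSl_lie, toForm_mk, toForm_mk, toSl_mk, toSl_mk, coe_momentSl,
        coe_momentSl, map_neg, map_neg, map_neg, map_neg, LinearMap.neg_apply,
        LinearMap.neg_apply, neg_neg, neg_neg]
    · rw [toForm_mk, toForm_lie, toForm_lie, toForm_mk, toForm_mk, toSl_mk, toSl_mk, map_neg,
        map_neg]
      abel
  left_inv x := by
    apply ext
    · rfl
    · rw [toForm_mk, toForm_mk, neg_neg]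
  right_inv x := by
    apply ext
    · rfl
    · rw [toForm_mk, toForm_mk, neg_neg]

/-- The even part `𝔤₀ = {x | θ x = x}`. -/
def gZero (K : Type*) [Field K] [CharZero K] : Submodule K (E7 K) :=
  Module.End.eigenspace (theta K : E7 K →ₗ[K] E7 K) 1

/-- The odd part `𝔤₁ = {x | θ x = -x}`. -/
def gOne (K : Type*) [Field K] [CharZero K] : Submodule K (E7 K) :=
  Module.End.eigenspace (theta K : E7 K →ₗ[K] E7 K) (-1)

theorem mem_gZero {K : Type*} [Field K] [CharZero K] (x : E7 K) :
    x ∈ gZero K ↔ toForm K x = 0 := by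
  have h : x ∈ gZero K ↔ theta K x = (1 : K) • x := Module.End.mem_eigenspace_iff
  rw [h, one_smul]
  constructor
  · intro h
    have h1 : -toForm K x = toForm K x := congrArg (toForm K) h
    have h2 : (2 : K) • toForm K x = 0 := by
      rw [two_smul]; nth_rewrite 1 [← h1]; exact neg_add_cancel _
    exact (smul_eq_zero.1 h2).resolve_left two_ne_zero
  · intro h
    apply ext
    · rfl
    · change -toForm K x = toForm K x
      rw [h, neg_zero]

theorem mem_gOne {K : Type*} [Field K] [CharZero K] (x : E7 K) :
    x ∈ gOne K ↔ toSl K x = 0 := by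
  have h : x ∈ gOne K ↔ theta K x = (-1 : K) • x := Module.End.mem_eigenspace_iff
  rw [h, neg_smul, one_smul]
  constructor
  · intro h
    have h1 : toSl K x = -toSl K x := (congrArg (toSl K) h).trans (map_neg _ _)
    have h2 : (2 : K) • toSl K x = 0 := by
      rw [two_smul]; nth_rewrite 1 [h1]; exact neg_add_cancel _
    exact (smul_eq_zero.1 h2).resolve_left two_ne_zero
  · intro h
    apply ext
    · change (toSl K x : Matrix (Fin 8) (Fin 8) K) = toSl K (-x)
      rw [map_neg, h, neg_zero]
    · exact (map_neg (toForm K) x).symm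

/-- The group representation of the `8 × 8` matrices on `⋀⁴ K⁸`:
`g · (v₁ ∧ v₂ ∧ v₃ ∧ v₄) = g v₁ ∧ g v₂ ∧ g v₃ ∧ g v₄`. -/
def gAct {K : Type*} [Field K] (g : Matrix (Fin 8) (Fin 8) K) :
    Module.End K (⋀[K]^4 (Fin 8 → K)) :=
  exteriorPower.map 4 (Matrix.toLin' g)

theorem gAct_ιMulti {K : Type*} [Field K] (g : Matrix (Fin 8) (Fin 8) K)
    (v : Fin 4 → Fin 8 → K) :
    gAct g (exteriorPower.ιMulti K 4 v) = exteriorPower.ιMulti K 4 fun i => g.mulVec (v i) := by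
  rw [gAct, exteriorPower.map_apply_ιMulti]
  rfl

theorem gAct_one {K : Type*} [Field K] (u : ⋀[K]^4 (Fin 8 → K)) :
    gAct (1 : Matrix (Fin 8) (Fin 8) K) u = u := by
  rw [gAct, Matrix.toLin'_one, exteriorPower.map_id]; rfl

theorem gAct_mul {K : Type*} [Field K] (g h : Matrix (Fin 8) (Fin 8) K)
    (u : ⋀[K]^4 (Fin 8 → K)) : gAct (g * h) u = gAct g (gAct h u) := by
  rw [gAct, Matrix.toLin'_mul]
  exact (LinearMap.congr_fun (exteriorPower.map_comp (n := 4) (Matrix.toLin' h) (Matrix.toLin' g)) u)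

theorem gAct_act {K : Type*} [Field K] (g A B : Matrix (Fin 8) (Fin 8) K)
    (h : g * A = B * g) (u : ⋀[K]^4 (Fin 8 → K)) :
    gAct g (act K A u) = act K B (gAct g u) := by
  have : (gAct g).comp (act K A) = (act K B).comp (gAct g) := by
    apply exteriorPower.linearMap_ext
    ext1 v
    simp only [LinearMap.compAlternatingMap_apply, LinearMap.comp_apply, gAct_ιMulti, act_ιMulti,
      map_sum]
    refine Finset.sum_congr rfl fun k _ => ?_
    congr 1
    funext i
    by_cases hi : i = k
    · subst hi
      rw [Function.update_self, Function.update_self, Matrix.mulVec_mulVec, Matrix.mulVec_mulVec, h]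
    · rw [Function.update_of_ne hi, Function.update_of_ne hi]
  exact LinearMap.congr_fun this u

theorem pairing_gAct {K : Type*} [Field K] (g : Matrix (Fin 8) (Fin 8) K)
    (u v : ⋀[K]^4 (Fin 8 → K)) :
    pairing K (gAct g u) (gAct g v) = g.det * pairing K u v := by
  have : (pairing K).compl₁₂ (gAct g) (gAct g) = g.det • pairing K := by
    apply exteriorPower.linearMap_ext
    ext1 a
    apply exteriorPower.linearMap_ext
    ext1 b
    simp only [LinearMap.compAlternatingMap_apply, LinearMap.compl₁₂_apply, gAct_ιMulti,
      LinearMap.smul_apply, pairing_ιMulti, smul_eq_mul]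
    have h : (Fin.append (fun i => g.mulVec (a i)) (fun i => g.mulVec (b i)) :
        Fin 8 → Fin 8 → K) = ((Matrix.of (Fin.append a b : Fin 8 → Fin 8 → K)) * g.transpose :
          Matrix (Fin 8) (Fin 8) K) := by
      funext i
      rw [Matrix.mul_apply_eq_vecMul, Matrix.vecMul_transpose]
      refine Fin.addCases (m := 4) (n := 4) (fun i => ?_) (fun i => ?_) i
      · rw [Fin.append_left]
        exact congrArg g.mulVec (Fin.append_left a b i).symm
      · rw [Fin.append_right]
        exact congrArg g.mulVec (Fin.append_right a b i).symm
    refine (congrArg Matrix.det h).trans ?_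
    rw [Matrix.det_mul, Matrix.det_transpose, mul_comm]
    rfl
  exact LinearMap.congr_fun₂ this u v

theorem moment_gAct {K : Type*} [Field K] (g : Matrix.SpecialLinearGroup (Fin 8) K)
    (u v : ⋀[K]^4 (Fin 8 → K)) :
    moment K (gAct g.1 u) (gAct g.1 v) = g.1 * moment K u v * g⁻¹.1 := by
  have h1 : g.1 * g⁻¹.1 = 1 := congrArg Subtype.val (mul_inv_cancel g)
  have hx : ∀ X Y : Matrix (Fin 8) (Fin 8) K,
      (∀ B, (X * B).trace = (Y * B).trace) → X = Y := by
    intro X Y h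
    ext i j
    simpa [Matrix.trace_mul_single] using h (Matrix.single j i 1)
  apply hx
  intro B
  have h2 := gAct_act g.1 (g⁻¹.1 * B * g.1) B
    (by rw [← mul_assoc, ← mul_assoc, h1, one_mul]) u
  have h3 := trace_moment_mul u v (g⁻¹.1 * B * g.1)
  rw [trace_moment_mul, ← h2, pairing_gAct, g.2, one_mul, ← h3, mul_assoc g.1, mul_assoc g.1,
    Matrix.trace_mul_comm]
  simp only [mul_assoc]
  rw [← mul_assoc, Matrix.trace_mul_comm, mul_assoc]

/-- The linear action of `SL(8, K)`: `g · (A + u) = g A g⁻¹ + (⋀⁴ g) u`. -/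
def slMap {K : Type*} [Field K] (g : Matrix.SpecialLinearGroup (Fin 8) K) : E7 K →ₗ[K] E7 K where
  toFun x := mk ⟨g.1 * (toSl K x : Matrix (Fin 8) (Fin 8) K) * g⁻¹.1, by
    have h1 : g⁻¹.1 * g.1 = 1 := congrArg Subtype.val (inv_mul_cancel g)
    refine LinearMap.mem_ker.2 ?_
    rw [Matrix.traceLinearMap_apply, Matrix.trace_mul_cycle, h1, one_mul, trace_toSl]⟩
    (gAct g.1 (toForm K x))
  map_add' x y := by
    apply ext
    · change g.1 * (toSl K (x + y) : Matrix (Fin 8) (Fin 8) K) * g⁻¹.1 =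
        g.1 * (toSl K x : Matrix (Fin 8) (Fin 8) K) * g⁻¹.1 +
        g.1 * (toSl K y : Matrix (Fin 8) (Fin 8) K) * g⁻¹.1
      rw [map_add, coe_add, mul_add, add_mul]
    · exact ((congrArg (gAct g.1) (map_add (toForm K) x y)).trans (map_add _ _ _))
  map_smul' c x := by
    apply ext
    · change g.1 * (toSl K (c • x) : Matrix (Fin 8) (Fin 8) K) * g⁻¹.1 =
        c • (g.1 * (toSl K x : Matrix (Fin 8) (Fin 8) K) * g⁻¹.1)
      rw [map_smul, coe_smul, Matrix.mul_smul, Matrix.smul_mul]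
    · exact ((congrArg (gAct g.1) (map_smul (toForm K) c x)).trans (map_smul _ _ _))

theorem toSl_slMap {K : Type*} [Field K] (g : Matrix.SpecialLinearGroup (Fin 8) K) (x : E7 K) :
    (toSl K (slMap g x) : Matrix (Fin 8) (Fin 8) K) =
      g.1 * (toSl K x : Matrix (Fin 8) (Fin 8) K) * g⁻¹.1 := rfl

theorem toForm_slMap {K : Type*} [Field K] (g : Matrix.SpecialLinearGroup (Fin 8) K) (x : E7 K) :
    toForm K (slMap g x) = gAct g.1 (toForm K x) := rfl

theorem slMap_one {K : Type*} [Field K] (x : E7 K) :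
    slMap (1 : Matrix.SpecialLinearGroup (Fin 8) K) x = x := by
  apply ext
  · rw [toSl_slMap, inv_one, Matrix.SpecialLinearGroup.coe_one, one_mul, mul_one]
  · rw [toForm_slMap, Matrix.SpecialLinearGroup.coe_one, gAct_one]

theorem slMap_mul {K : Type*} [Field K] (g h : Matrix.SpecialLinearGroup (Fin 8) K) (x : E7 K) :
    slMap (g * h) x = slMap g (slMap h x) := by
  apply ext
  · rw [toSl_slMap, toSl_slMap, toSl_slMap, mul_inv_rev, Matrix.SpecialLinearGroup.coe_mul,
      Matrix.SpecialLinearGroup.coe_mul]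
    simp only [mul_assoc]
  · rw [toForm_slMap, toForm_slMap, toForm_slMap, Matrix.SpecialLinearGroup.coe_mul, gAct_mul]

theorem slMap_lie {K : Type*} [Field K] [CharZero K] (g : Matrix.SpecialLinearGroup (Fin 8) K)
    (x y : E7 K) : slMap g ⁅x, y⁆ = ⁅slMap g x, slMap g y⁆ := by
  have h1 : g⁻¹.1 * g.1 = 1 := congrArg Subtype.val (inv_mul_cancel g)
  have hA : ∀ A : Matrix (Fin 8) (Fin 8) K, g.1 * A = g.1 * A * g⁻¹.1 * g.1 := by
    intro A
    rw [mul_assoc _ g⁻¹.1, h1, mul_one]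
  have hm : ∀ A B : Matrix (Fin 8) (Fin 8) K,
      g.1 * (A * B) * g⁻¹.1 = g.1 * A * g⁻¹.1 * (g.1 * B * g⁻¹.1) := by
    intro A B
    rw [← mul_assoc, ← mul_assoc, ← mul_assoc, ← hA]
  apply ext
  · have h2 : (momentSl K (gAct g.1 (toForm K x)) (gAct g.1 (toForm K y)) :
        Matrix (Fin 8) (Fin 8) K) = g.1 * momentSl K (toForm K x) (toForm K y) * g⁻¹.1 := by
      have h3 : g.1 * g⁻¹.1 = 1 := congrArg Subtype.val (mul_inv_cancel g)
      rw [coe_momentSl, coe_momentSl, moment_gAct, pairing_gAct, g.2, one_mul, mul_sub, sub_mul,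
        Matrix.mul_smul, mul_one, Matrix.smul_mul, h3]
    rw [toSl_slMap, toSl_lie, toSl_lie, toSl_slMap, toSl_slMap, toForm_slMap, toForm_slMap, h2,
      mul_add, add_mul, mul_sub, sub_mul, hm, hm]
  · have e1 := gAct_act g.1 (toSl K x) _ (hA _) (toForm K y)
    have e2 := gAct_act g.1 (toSl K y) _ (hA _) (toForm K x)
    rw [toForm_slMap, toForm_lie, map_sub, e1, e2]
    rfl

/-- `SL(8, K)` acts by automorphisms: `g · (A + u) = g A g⁻¹ + (⋀⁴ g) u`. -/
def slAut {K : Type*} [Field K] [CharZero K] (g : Matrix.SpecialLinearGroup (Fin 8) K) :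
    E7 K ≃ₗ⁅K⁆ E7 K where
  __ := slMap g
  map_lie' {x y} := slMap_lie g x y
  invFun := slMap g⁻¹
  left_inv x := by
    change slMap g⁻¹ (slMap g x) = x
    rw [← slMap_mul, inv_mul_cancel, slMap_one]
  right_inv x := by
    change slMap g (slMap g⁻¹ x) = x
    rw [← slMap_mul, mul_inv_cancel, slMap_one]

instance (K : Type*) [Field K] [CharZero K] :
    MulAction (Matrix.SpecialLinearGroup (Fin 8) K) (E7 K) where
  smul g x := slAut g x
  one_smul := slMap_one
  mul_smul := slMap_mul

theorem toSl_smul {K : Type*} [Field K] [CharZero K] (g : Matrix.SpecialLinearGroup (Fin 8) K)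
    (x : E7 K) : (toSl K (g • x) : Matrix (Fin 8) (Fin 8) K) =
      g.1 * (toSl K x : Matrix (Fin 8) (Fin 8) K) * g⁻¹.1 := rfl

theorem toForm_smul {K : Type*} [Field K] [CharZero K] (g : Matrix.SpecialLinearGroup (Fin 8) K)
    (x : E7 K) : toForm K (g • x) = gAct g.1 (toForm K x) := rfl

/-- Homogeneous `𝔰𝔩₂`-triples. The trivial triple `(0, 0, 0)` is allowed. -/
structure IsHomogeneousSl2Triple {K : Type*} [Field K] [CharZero K] (h e f : E7 K) : Prop where
  h_mem : h ∈ gZero K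
  e_mem : e ∈ gOne K
  f_mem : f ∈ gOne K
  lie_h_e : ⁅h, e⁆ = (2 : K) • e
  lie_h_f : ⁅h, f⁆ = -((2 : K) • f)
  lie_e_f : ⁅e, f⁆ = h

end E7

end

end SplitE7

/-! Existence follows the Jacobson–Morozov argument, kept inside the grading. Let `e` be a nilpotent
element of 𝔤₁. The operator (ad e)² on 𝔤₁ is self-adjoint for the wedge pairing, which is
nondegenerate, so its image is the orthogonal of its kernel. If (ad e)² z = 0, then ad e commutes
with [ad e, ad z], and Jacobson's lemma makes ad z ∘ ad e nilpotent. Up to sign its restriction to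
𝔰𝔩₈ is A ↦ μ(z, A·e), whose trace is −18 times the pairing of z and e. Hence e is orthogonal to the
kernel and e = (ad e)² v for some v in 𝔤₁. Then h = −2[e, v] lies in 𝔤₀ and satisfies [h, e] = 2e,
Morozov's lemma supplies f, and the 𝔤₁-component of f still works. This computation replaces the
Killing form and is valid over every field of characteristic zero (`exists_isHomogeneousSl2Triple`).

For conjugacy one may move the second triple so that e' = e. The difference h' − h = [e, f' − f]
lies both in the centralizer of e and in the image of ad e, so it is a sum of eigenvectors of ad h
with positive integral eigenvalues. Since h and h' both act on e by 2, the difference annihilates e.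
If it has weights at least k, conjugating h' by exp((h' − h)/k) removes the part of weight k. This
exponential is unipotent, hence of determinant one, and it fixes e. After finitely many such steps
h' becomes h (`exists_smul_eq_of_mem_weightFiltration`), and f is then determined by h and e
(`f_unique`). The argument only needs exponentials of nilpotent matrices, so ℝ and ℂ are treated
together through `RCLike`. -/

/-! ### Jacobson's lemma on nilpotent commutators -/

/-- The derivation D = [a, ·] sends b to c = [a, b] and kills c. In the Leibniz expansion of Dⁿ(bⁿ)
only the terms with one D on each factor survive, which gives n! cⁿ. D is nilpotent, being the
difference of two commuting nilpotent multiplications. -/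
theorem isNilpotent_commutator_of_commute {K A : Type*} [Field K] [CharZero K] [Ring A]
    [Algebra K A] {a b : A} (ha : IsNilpotent a) (hc : Commute a (a * b - b * a)) :
    IsNilpotent (a * b - b * a) := by
  set c := a * b - b * a with hcdef
  let D : Module.End K A := LinearMap.mulLeft K a - LinearMap.mulRight K a
  have hD : ∀ x, D x = a * x - x * a := fun x => rfl
  have hDb : D b = c := rfl
  have hDc : D c = 0 := by rw [hD, hc.eq, sub_self]
  have hDmul : ∀ x y, D (x * y) = D x * y + x * D y := by
    intro x y; simp only [hD]; noncomm_ring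
  have hDcp : ∀ n, D (c ^ n) = 0 := by
    intro n
    rw [hD, (hc.pow_right n).eq, sub_self]
  -- The Leibniz formula stops after two terms because D² b = 0.
  have hL : ∀ m x, (D ^ (m + 1)) (b * x) =
      b * (D ^ (m + 1)) x + ((m + 1 : ℕ) : K) • (c * (D ^ m) x) := by
    intro m x
    induction m with
    | zero => simp [hDmul, hcdef, hD b]; abel
    | succ m ih =>
      rw [pow_succ' D (m + 1), Module.End.mul_apply, ih, map_add, map_smul, hDmul, hDmul, hDc,
        zero_mul, zero_add, hDb, ← Module.End.mul_apply D, ← Module.End.mul_apply D, ← pow_succ' D m]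
      push_cast
      module
  have key : ∀ n, (D ^ n) (b ^ n) = (n.factorial : K) • c ^ n := by
    intro n
    induction n with
    | zero => simp
    | succ n ih =>
      rw [pow_succ' b, hL, pow_succ' D, Module.End.mul_apply, ih, map_smul, hDcp, smul_zero,
        mul_zero, zero_add, mul_smul_comm, smul_smul, ← pow_succ', Nat.factorial_succ]
      push_cast
      rfl
  obtain ⟨n, hn⟩ : IsNilpotent D := (LinearMap.commute_mulLeft_right a a).isNilpotent_sub
    ((LinearMap.isNilpotent_mulLeft_iff K a).2 ha) ((LinearMap.isNilpotent_mulRight_iff K a).2 ha)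
  refine ⟨n, ?_⟩
  have h := key n
  rw [hn, LinearMap.zero_apply] at h
  exact (smul_eq_zero.1 h.symm).resolve_left (Nat.cast_ne_zero.2 n.factorial_ne_zero)

/-- If `a` is nilpotent and commutes with `a * b - b * a`, then `b * a` is nilpotent. -/
theorem isNilpotent_mul_of_commute_commutator {K A : Type*} [Field K] [CharZero K] [Ring A]
    [Algebra K A] {a b : A} (ha : IsNilpotent a) (hc : Commute a (a * b - b * a)) :
    IsNilpotent (b * a) := by
  obtain ⟨N, hN⟩ := isNilpotent_commutator_of_commute (K := K) ha hc
  obtain ⟨n, hn⟩ := ha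
  set c := a * b - b * a with hcdef
  have hab : a * b = b * a + c := by rw [hcdef]; abel
  have h1 : ∀ k : ℕ, a ^ k * (b * a) = b * a ^ (k + 1) + k • (c * a ^ k) := by
    intro k
    induction k with
    | zero => simp
    | succ k ih =>
      rw [pow_succ' a k, mul_assoc, ih, mul_add, ← mul_assoc, hab, mul_smul_comm, ← mul_assoc a c,
        hc.eq, pow_succ' a (k + 1), pow_succ' a k, add_smul, one_smul]
      simp only [add_mul, mul_assoc]
      abel
  -- On ker aᵏ⁺¹ modulo ker aᵏ, viewed through aᵏ, left multiplication by b a acts as k c. Since c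
  -- is nilpotent, a power of b a carries ker aᵏ⁺¹ into ker aᵏ, and this descends to zero.
  have h2 : ∀ (k m : ℕ) (x : A), a ^ (k + 1) * x = 0 →
      a ^ k * ((b * a) ^ m * x) = k ^ m • (c ^ m * (a ^ k * x)) ∧
        a ^ (k + 1) * ((b * a) ^ m * x) = 0 := by
    intro k m x hx
    induction m with
    | zero => simp [hx]
    | succ m ih =>
      obtain ⟨i1, i2⟩ := ih
      constructor
      · rw [pow_succ' (b * a), mul_assoc, ← mul_assoc (a ^ k), h1, add_mul, mul_assoc b, i2,
          mul_zero, zero_add, smul_mul_assoc, mul_assoc c, i1, mul_smul_comm, smul_smul,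
          ← mul_assoc c, ← pow_succ', ← pow_succ']
      · have i3 : a ^ (k + 1 + 1) * ((b * a) ^ m * x) = 0 := by
          rw [pow_succ', mul_assoc, i2, mul_zero]
        rw [pow_succ' (b * a), mul_assoc, ← mul_assoc (a ^ (k + 1)), h1, add_mul, mul_assoc b, i3,
          mul_zero, zero_add, smul_mul_assoc, mul_assoc c, i2, mul_zero, smul_zero]
  have h3 : ∀ (k : ℕ) (x : A), a ^ k * x = 0 → (b * a) ^ (N * k) * x = 0 := by
    intro k
    induction k with
    | zero => intro x hx; simpa using hx
    | succ k ih =>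
      intro x hx
      have := ih ((b * a) ^ N * x) (by rw [(h2 k N x hx).1, hN, zero_mul, smul_zero])
      rwa [← mul_assoc, ← pow_add] at this
  refine ⟨N * n, ?_⟩
  simpa using h3 n 1 (by rw [hn, zero_mul])

/-! ### Morozov's lemma -/

theorem pow_succ_mul_eq_of_sl2_relations {A : Type*} [Ring A] {H E F : A} (hEF : E * F = F * E + H)
    (hHE : H * E = E * H + 2 * E) (k : ℕ) :
    E ^ (k + 1) * F = F * E ^ (k + 1) + (k + 1) * ((H - k) * E ^ k) := by
  have hEH : E * H = H * E - 2 * E := by rw [hHE]; abel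
  induction k with
  | zero => simp [hEF]
  | succ k ih =>
    have e1 : E * ((k + 1 : A) * ((H - k) * E ^ k)) =
        (k + 1) * ((H - 2 - k) * E ^ (k + 1)) := by
      have hk : E * (k + 1 : A) = (k + 1) * E := by
        exact_mod_cast ((Nat.cast_commute (k + 1) E).symm).eq
      have hk' : E * (k : A) = k * E := ((Nat.cast_commute k E).symm).eq
      rw [← mul_assoc, hk, mul_assoc, ← mul_assoc E, mul_sub, hEH, hk', pow_succ']
      noncomm_ring
    rw [pow_succ' E (k + 1), mul_assoc, ih, mul_add, ← mul_assoc, hEF, e1]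
    push_cast
    noncomm_ring

section LieAlgebra

variable {K L : Type*} [Field K] [LieRing L] [LieAlgebra K L]

/-- This is the usual 𝔰𝔩₂ identity, in which the bracket of h with y plays no role. It is therefore
available before y has been corrected to an element of weight −2. -/
theorem LieAlgebra.ad_pow_lie_eq {h e y x : L} (he : ⁅h, e⁆ = (2 : K) • e) (hy : ⁅e, y⁆ = h) (k : ℕ)
    (hx : ⁅e, ((LieAlgebra.ad K L e) ^ k) x⁆ = 0) :
    ((LieAlgebra.ad K L e) ^ (k + 1)) ⁅y, x⁆ =
      (k + 1 : K) • (⁅h, ((LieAlgebra.ad K L e) ^ k) x⁆ - (k : K) • ((LieAlgebra.ad K L e) ^ k) x) := by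
  have h1 : LieAlgebra.ad K L e * LieAlgebra.ad K L y =
      LieAlgebra.ad K L y * LieAlgebra.ad K L e + LieAlgebra.ad K L h := by
    ext z
    simp [← hy]
  have h2 : LieAlgebra.ad K L h * LieAlgebra.ad K L e =
      LieAlgebra.ad K L e * LieAlgebra.ad K L h + 2 * LieAlgebra.ad K L e := by
    ext z
    have : (2 : Module.End K L) = (2 : K) • (1 : Module.End K L) := by
      ext; simp [two_smul]
    simp [leibniz_lie h, he, this, add_comm]
  have h3 := LinearMap.congr_fun (pow_succ_mul_eq_of_sl2_relations h1 h2 k) x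
  have h4 : ((LieAlgebra.ad K L e) ^ (k + 1)) x = 0 := by
    rw [pow_succ', Module.End.mul_apply]; exact hx
  have h5 : ∀ (m : ℕ) (z : L), (m : Module.End K L) z = (m : K) • z := by
    intro m z
    rw [Module.End.natCast_apply, Nat.cast_smul_eq_nsmul]
  have h6 : ∀ z : L, (k + 1 : Module.End K L) z = (k + 1 : K) • z := by
    intro z; exact_mod_cast h5 (k + 1) z
  simpa only [Module.End.mul_apply, LinearMap.add_apply, h4, map_zero, zero_add, h6,
    LinearMap.sub_apply, h5, LieAlgebra.ad_apply] using h3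

/-- The span of the eigenvectors of `ad h` in the centralizer of `e` with eigenvalue a natural
number at least `k`. -/
def LieAlgebra.centralizerFiltration (K : Type*) {L : Type*} [Field K] [LieRing L] [LieAlgebra K L]
    (h e : L) (k : ℕ) : Submodule K L :=
  Submodule.span K {x | ⁅e, x⁆ = 0 ∧ ∃ i : ℕ, k ≤ i ∧ ⁅h, x⁆ = (i : K) • x}

/-- Decreasing induction on k from the nilpotency index of ad e. For w = (ad e)ᵏ x in the
centralizer, `ad_pow_lie_eq` writes (ad h − k) w as an element of the image of (ad e)ᵏ⁺¹, which the
induction hypothesis controls. No semisimplicity of ad h is assumed; diagonalizability on these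
vectors is part of the conclusion. -/
theorem LieAlgebra.mem_centralizerFiltration [CharZero K] {h e y : L} (he : ⁅h, e⁆ = (2 : K) • e)
    (hy : ⁅e, y⁆ = h) (hn : IsNilpotent (LieAlgebra.ad K L e)) (k : ℕ) (x : L)
    (hx : ⁅e, ((LieAlgebra.ad K L e) ^ k) x⁆ = 0) :
    ((LieAlgebra.ad K L e) ^ k) x ∈ LieAlgebra.centralizerFiltration K h e k := by
  obtain ⟨n, hn⟩ := hn
  rcases le_total n k with hk | hk
  · rw [pow_eq_zero_of_le hk hn, LinearMap.zero_apply]; exact zero_mem _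
  induction hk using Nat.decreasingInduction generalizing x with
  | self => rw [hn, LinearMap.zero_apply]; exact zero_mem _
  | of_succ k hk ih =>
  have h1 := LieAlgebra.ad_pow_lie_eq he hy k hx
  set w := ((LieAlgebra.ad K L e) ^ k) x with hw
  have hk0 : (k + 1 : K) ≠ 0 := by exact_mod_cast k.succ_ne_zero
  have h2 : ((LieAlgebra.ad K L e) ^ (k + 1)) ((k + 1 : K)⁻¹ • ⁅y, x⁆) = ⁅h, w⁆ - (k : K) • w := by
    rw [map_smul, h1, smul_smul, inv_mul_cancel₀ hk0, one_smul]
  have h3 : ⁅e, ⁅h, w⁆ - (k : K) • w⁆ = 0 := by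
    rw [lie_sub, lie_smul, hx, leibniz_lie, ← lie_skew e h, he, hx]; simp [hx]
  have h4 := ih ((k + 1 : K)⁻¹ • ⁅y, x⁆) (by rw [h2]; exact h3)
  rw [h2] at h4
  -- The operator ad h − k is onto here, because it scales a vector of weight i > k by i − k ≠ 0.
  have h5 : ∀ v ∈ LieAlgebra.centralizerFiltration K h e (k + 1),
      ∃ v' ∈ LieAlgebra.centralizerFiltration K h e (k + 1), ⁅e, v'⁆ = 0 ∧
        ⁅h, v'⁆ - (k : K) • v' = v := by
    intro v hv
    refine Submodule.span_induction ?_ ?_ ?_ ?_ hv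
    · rintro v ⟨hv1, i, hi, hv2⟩
      have hik : (i - k : K) ≠ 0 := sub_ne_zero.2 (by exact_mod_cast (by omega : i ≠ k))
      refine ⟨(i - k : K)⁻¹ • v, Submodule.smul_mem _ _ (Submodule.subset_span ⟨hv1, i, hi, hv2⟩),
        by rw [lie_smul, hv1, smul_zero], ?_⟩
      rw [lie_smul, hv2, smul_comm (k : K), ← smul_sub, ← sub_smul, smul_smul, inv_mul_cancel₀ hik,
        one_smul]
    · exact ⟨0, zero_mem _, by simp, by simp⟩
    · rintro a b - - ⟨a', ha, ha1, ha2⟩ ⟨b', hb, hb1, hb2⟩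
      refine ⟨a' + b', add_mem ha hb, by rw [lie_add, ha1, hb1, add_zero], ?_⟩
      rw [← ha2, ← hb2, lie_add, smul_add]; abel
    · rintro c a - ⟨a', ha, ha1, ha2⟩
      refine ⟨c • a', Submodule.smul_mem _ _ ha, by rw [lie_smul, ha1, smul_zero], ?_⟩
      rw [← ha2, lie_smul, smul_comm (k : K), ← smul_sub]
  obtain ⟨v, hv, hev, hvw⟩ := h5 _ h4
  -- The vector w − v is killed by ad h − k, so it has weight exactly k.
  have h6 : w - v ∈ LieAlgebra.centralizerFiltration K h e k := by
    refine Submodule.subset_span ⟨by rw [lie_sub, hx, hev, sub_zero], k, le_rfl, ?_⟩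
    rw [lie_sub, smul_sub, sub_eq_sub_iff_sub_eq_sub, hvw]
  have h7 : LieAlgebra.centralizerFiltration K h e (k + 1) ≤ LieAlgebra.centralizerFiltration K h e k := by
    refine Submodule.span_mono ?_
    rintro z ⟨h1, i, hi, h2⟩
    exact ⟨h1, i, by omega, h2⟩
  rw [← sub_add_cancel w v]
  exact add_mem h6 (h7 hv)

/-- Morozov's completion of a pair `(h, e)` to an `𝔰𝔩₂`-triple. -/
theorem LieAlgebra.exists_sl2_completion [CharZero K] {h e y : L} (he : ⁅h, e⁆ = (2 : K) • e)
    (hy : ⁅e, y⁆ = h) (hn : IsNilpotent (LieAlgebra.ad K L e)) :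
    ∃ f : L, ⁅h, f⁆ = -((2 : K) • f) ∧ ⁅e, f⁆ = h := by
  -- The failure of y to have weight −2 lies in the centralizer of e. All weights there are natural
  -- numbers, so ad h + 2 is onto, and subtracting a preimage from y yields f.
  have h0 : ⁅e, ⁅h, y⁆ + (2 : K) • y⁆ = 0 := by
    rw [lie_add, lie_smul, leibniz_lie, ← lie_skew e h, he, neg_lie, smul_lie, hy, lie_self]
    simp
  have h1 := LieAlgebra.mem_centralizerFiltration he hy hn 0 (⁅h, y⁆ + (2 : K) • y) (by simpa using h0)
  rw [pow_zero, Module.End.one_apply] at h1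
  have h5 : ∀ v ∈ LieAlgebra.centralizerFiltration K h e 0,
      ∃ v', ⁅e, v'⁆ = 0 ∧ ⁅h, v'⁆ + (2 : K) • v' = v := by
    intro v hv
    refine Submodule.span_induction ?_ ?_ ?_ ?_ hv
    · rintro v ⟨hv1, i, hi, hv2⟩
      have hik : (i + 2 : K) ≠ 0 := by exact_mod_cast (by omega : i + 2 ≠ 0)
      refine ⟨(i + 2 : K)⁻¹ • v, by rw [lie_smul, hv1, smul_zero], ?_⟩
      rw [lie_smul, hv2, smul_comm (2 : K), ← smul_add, ← add_smul, smul_smul, inv_mul_cancel₀ hik,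
        one_smul]
    · exact ⟨0, by simp, by simp⟩
    · rintro a b - - ⟨a', ha1, ha2⟩ ⟨b', hb1, hb2⟩
      refine ⟨a' + b', by rw [lie_add, ha1, hb1, add_zero], ?_⟩
      rw [← ha2, ← hb2, lie_add, smul_add]; abel
    · rintro c a - ⟨a', ha1, ha2⟩
      refine ⟨c • a', by rw [lie_smul, ha1, smul_zero], ?_⟩
      rw [← ha2, lie_smul, smul_comm (2 : K), ← smul_add]
  obtain ⟨z, hz, hz'⟩ := h5 _ h1
  refine ⟨y - z, ?_, by rw [lie_sub, hz, hy, sub_zero]⟩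
  rw [lie_sub, smul_sub, eq_neg_iff_add_eq_zero]
  rw [← sub_eq_zero.2 hz'.symm]
  abel

/-- If z = (ad e)ᵏ x, then `ad_pow_lie_eq` gives (ad e)ᵏ⁺¹ [y, x] = (k + 1)(−2 − k) z with a nonzero
factor. Thus z lies in the image of every power of the nilpotent ad e. -/
theorem LieAlgebra.eq_zero_of_lie_eq_neg_two_smul [CharZero K] {h e y z : L} (he : ⁅h, e⁆ = (2 : K) • e)
    (hy : ⁅e, y⁆ = h) (hn : IsNilpotent (LieAlgebra.ad K L e)) (hz : ⁅e, z⁆ = 0)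
    (hz' : ⁅h, z⁆ = -((2 : K) • z)) : z = 0 := by
  obtain ⟨n, hn⟩ := hn
  have key : ∀ k, ∃ x, ((LieAlgebra.ad K L e) ^ k) x = z := by
    intro k
    induction k with
    | zero => exact ⟨z, rfl⟩
    | succ k ih =>
      obtain ⟨x, hx⟩ := ih
      have h1 := LieAlgebra.ad_pow_lie_eq he hy k (x := x) (by rw [hx, hz])
      rw [hx, hz', ← neg_smul, ← sub_smul, smul_smul] at h1
      have hk : ((k + 1) * (-2 - k) : K) ≠ 0 := by
        have : ((k + 1) * (-2 - k) : K) = -(((k + 1) * (k + 2) : ℕ) : K) := by push_cast; ring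
        rw [this]
        exact neg_ne_zero.2 (Nat.cast_ne_zero.2 (by positivity))
      refine ⟨((k + 1) * (-2 - k) : K)⁻¹ • ⁅y, x⁆, ?_⟩
      rw [map_smul, h1, smul_smul, inv_mul_cancel₀ hk, one_smul]
  obtain ⟨x, hx⟩ := key n
  rw [← hx, hn, LinearMap.zero_apply]

end LieAlgebra

/-! ### Nilpotency from finiteness of the set of weights -/

theorem Module.End.exists_forall_ge_eq_zero_of_eq_smul {K V : Type*} [Field K] [CharZero K] [AddCommGroup V]
    [Module K V] [FiniteDimensional K V] (T : Module.End K V) :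
    ∃ N : ℕ, ∀ i ≥ N, ∀ x, T x = (i : K) • x → x = 0 := by
  have h1 : {i : ℕ | T.HasEigenvalue (i : K)}.Finite :=
    T.finite_hasEigenvalue.preimage (Nat.cast_injective.injOn)
  obtain ⟨N, hN⟩ := h1.bddAbove
  refine ⟨N + 1, fun i hi x hx => ?_⟩
  by_contra h0
  have := hN (Module.End.hasEigenvalue_of_hasEigenvector
    ((Module.End.hasEigenvector_iff).2 ⟨Module.End.mem_eigenspace_iff.2 hx, h0⟩))
  omega

/-- Under commutation with ad h the power (ad e)ⁿ has eigenvalue 2n, and an operator on a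
finite-dimensional space has no large integral eigenvalues. -/
theorem LieAlgebra.isNilpotent_ad_of_lie_eq_two_smul {K L : Type*} [Field K] [CharZero K] [LieRing L]
    [LieAlgebra K L] [FiniteDimensional K L] {h e : L} (he : ⁅h, e⁆ = (2 : K) • e) :
    IsNilpotent (LieAlgebra.ad K L e) := by
  let T : Module.End K (Module.End K L) :=
    LinearMap.mulLeft K (LieAlgebra.ad K L h) - LinearMap.mulRight K (LieAlgebra.ad K L h)
  obtain ⟨N, hN⟩ := T.exists_forall_ge_eq_zero_of_eq_smul
  have h1 : T (LieAlgebra.ad K L e) = (2 : K) • LieAlgebra.ad K L e := by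
    ext z
    change ⁅h, ⁅e, z⁆⁆ - ⁅e, ⁅h, z⁆⁆ = (2 : K) • ⁅e, z⁆
    rw [leibniz_lie h e z, he, smul_lie, add_sub_cancel_right]
  have h2 : ∀ n, T (LieAlgebra.ad K L e ^ n) = ((2 * n : ℕ) : K) • LieAlgebra.ad K L e ^ n := by
    intro n
    induction n with
    | zero => simp [T]
    | succ n ih =>
      have hm : ∀ x y, T (x * y) = T x * y + x * T y := by
        intro x y
        change LieAlgebra.ad K L h * (x * y) - (x * y) * LieAlgebra.ad K L h =
          (LieAlgebra.ad K L h * x - x * LieAlgebra.ad K L h) * y +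
          x * (LieAlgebra.ad K L h * y - y * LieAlgebra.ad K L h)
        noncomm_ring
      rw [pow_succ, hm, ih, h1, smul_mul_assoc, mul_smul_comm, ← add_smul]
      push_cast
      ring_nf
  exact ⟨N, hN (2 * N) (by omega) _ (h2 N)⟩

/-! ### The trace of A ↦ μ(z, A·e) and nondegeneracy of the pairing -/

namespace SplitE7

noncomputable section

/-- The sum is the quadratic Casimir operator of 𝔤𝔩₈. On a word, the two matrix units may act at the
same position, which restores the word for each of 8 intermediate letters. At two different
positions they exchange two letters, which costs a sign. The total is 4·8 − 4·3 = 20. -/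
theorem sum_act_single_act_single {K : Type*} [Field K] (w : ⋀[K]^4 (Fin 8 → K)) :
    ∑ i, ∑ j, act K (Matrix.single j i 1) (act K (Matrix.single i j 1) w) = (20 : K) • w := by
  let N : Submodule K (⋀[K]^4 (Fin 8 → K)) := LinearMap.eqLocus
    (∑ i, ∑ j, act K (Matrix.single j i 1) * act K (Matrix.single i j 1)) ((20 : K) • 1)
  suffices h : w ∈ N by simpa [N, LinearMap.mem_eqLocus] using h
  refine span_words N (fun α _ => ?_) w
  rw [LinearMap.mem_eqLocus]
  simp only [LinearMap.sum_apply, Module.End.mul_apply, LinearMap.smul_apply, Module.End.one_apply]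
  have h1 : ∀ k l i, (if Function.update α k i l = i then
      word K (Function.update (Function.update α k i) l (α k)) else 0) =
      if l = k then word K α else if α l = i then - word K α else 0 := by
    intro k l i
    by_cases hl : l = k
    · subst hl; simp
    · rw [Function.update_of_ne hl, if_neg hl]
      split_ifs with h
      · have : Function.update (Function.update α k i) l (α k) = α ∘ Equiv.swap k l := by
          funext m
          simp only [Function.comp_apply, Function.update_apply, Equiv.swap_apply_def, ← h]
          split_ifs <;> simp_all
        rw [this, word_comp_perm, Equiv.Perm.sign_swap (Ne.symm hl)]
        simp
      · rfl
  have h2 : ∀ i j, act K (Matrix.single j i 1) (act K (Matrix.single i j 1) (word K α)) =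
      ∑ k, if α k = j then ∑ l, (if l = k then word K α else if α l = i then - word K α else 0)
        else 0 := by
    intro i j
    rw [act_single_word, map_sum]
    refine Finset.sum_congr rfl fun k _ => ?_
    split_ifs with h
    · rw [act_single_word]
      refine Finset.sum_congr rfl fun l _ => ?_
      rw [← h1, h]
    · rw [map_zero]
  have h3 : ∀ k l : Fin 4, ∑ i, (if l = k then word K α else if α l = i then - word K α else 0) =
      (if l = k then 8 else -1 : K) • word K α := by
    intro k l
    split_ifs
    · simp [← Nat.cast_smul_eq_nsmul K]
    · simp; exact (neg_one_smul K _).symm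
  simp only [h2]
  have h4 : ∀ i, (∑ j, ∑ k, if α k = j then
      ∑ l, (if l = k then word K α else if α l = i then - word K α else 0) else 0) =
      ∑ k, ∑ l, (if l = k then word K α else if α l = i then - word K α else 0) := by
    intro i
    rw [Finset.sum_comm]
    simp
  simp only [h4]
  rw [Finset.sum_comm]
  have h5 : ∀ k : Fin 4, (∑ i, ∑ l, if l = k then word K α else if α l = i then - word K α else 0) =
      (5 : K) • word K α := by
    intro k
    rw [Finset.sum_comm]
    simp only [h3]
    rw [← Finset.sum_smul]
    congr 1
    fin_cases k <;> simp [Fin.sum_univ_four] <;> norm_num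
  simp only [h5]
  simp [← Nat.cast_smul_eq_nsmul K, smul_smul]
  norm_num

/-- The operator `A ↦ μ(z, A · e)` on `8 × 8` matrices. -/
def momentAct {K : Type*} [Field K] [CharZero K] (z e : ⋀[K]^4 (Fin 8 → K)) :
    Module.End K (Matrix (Fin 8) (Fin 8) K) where
  toFun A := moment K z (act K A e) - (2⁻¹ * pairing K z (act K A e)) • 1
  map_add' A B := by simp only [map_add, LinearMap.add_apply]; module
  map_smul' c A := by simp only [map_smul, LinearMap.smul_apply, smul_eq_mul, RingHom.id_apply]; module

theorem momentAct_apply {K : Type*} [Field K] [CharZero K] (z e : ⋀[K]^4 (Fin 8 → K))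
    (A : Matrix (Fin 8) (Fin 8) K) :
    momentAct z e A = momentSl K z (act K A e) := (coe_momentSl _ _).symm

/-- By `pairing_act` the diagonal entries pair z with the summands of the Casimir operator,
contributing −20. The trace term of `pairing_act` and the scalar correction in μ leave one half of
the action of the identity matrix, contributing 4/2 = 2. What matters later is only that 2 − 20 ≠ 0.
-/
theorem trace_momentAct {K : Type*} [Field K] [CharZero K] (z e : ⋀[K]^4 (Fin 8 → K)) :
    LinearMap.trace K _ (momentAct z e) = -(18 * pairing K z e) := by
  rw [LinearMap.trace_eq_matrix_trace K (Matrix.stdBasis K (Fin 8) (Fin 8)), Matrix.trace]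
  have h1 : ∀ p : Fin 8 × Fin 8, (LinearMap.toMatrix (Matrix.stdBasis K (Fin 8) (Fin 8))
      (Matrix.stdBasis K (Fin 8) (Fin 8)) (momentAct z e)).diag p =
      (if p.1 = p.2 then 2⁻¹ * pairing K z (act K (Matrix.single p.1 p.2 1) e) else 0) -
        pairing K z (act K (Matrix.single p.2 p.1 1) (act K (Matrix.single p.1 p.2 1) e)) := by
    rintro ⟨i, j⟩
    have h2 := pairing_act (Matrix.single j i 1) z (act K (Matrix.single i j 1) e)
    rw [Matrix.diag, LinearMap.toMatrix_apply, Matrix.stdBasis_eq_single]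
    have h3 : ∀ M : Matrix (Fin 8) (Fin 8) K,
        (Matrix.stdBasis K (Fin 8) (Fin 8)).repr M (i, j) = M i j := fun M => rfl
    rw [h3]
    change (moment K z _ - _) i j = _
    rw [Matrix.sub_apply, moment_apply, Matrix.smul_apply, Matrix.one_apply]
    by_cases hij : i = j
    · subst hij
      rw [Matrix.trace_single_eq_same] at h2
      rw [if_pos rfl, if_pos rfl, smul_eq_mul]
      linear_combination h2
    · rw [Matrix.trace_single_eq_of_ne _ _ _ (Ne.symm hij)] at h2
      rw [if_neg hij, if_neg hij, smul_zero]
      linear_combination h2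
  have h4 : (∑ i, pairing K z (act K (Matrix.single i i 1) e)) = 4 * pairing K z e := by
    have : (∑ i, Matrix.single i i (1 : K)) = (1 : Matrix (Fin 8) (Fin 8) K) :=
      Matrix.sum_single_one
    rw [← map_sum, ← LinearMap.sum_apply, ← map_sum, this, act_one, map_smul, smul_eq_mul]
  have h5 := congrArg (pairing K z) (sum_act_single_act_single e)
  simp only [map_sum, map_smul, smul_eq_mul] at h5
  rw [Finset.sum_congr rfl fun p _ => h1 p, Fintype.sum_prod_type]
  simp only [Finset.sum_sub_distrib, h5, Finset.sum_ite_eq, Finset.mem_univ, if_true,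
    ← Finset.mul_sum, h4]
  ring

theorem wordSign_ne_zero {c : Fin 8 → Fin 8} (h : Function.Injective c) : wordSign c ≠ 0 := by
  refine Finset.prod_ne_zero_iff.2 fun i _ => Finset.prod_ne_zero_iff.2 fun j hj => ?_
  rw [if_neg fun hij => (Finset.mem_Ioi.1 hj).ne (h hij)]
  split_ifs <;> decide

theorem wordSign_eq_zero {c : Fin 8 → Fin 8} (h : ¬ Function.Injective c) : wordSign c = 0 := by
  simp only [Function.Injective, not_forall] at h
  obtain ⟨i, j, h, hij⟩ := h
  wlog hlt : i < j generalizing i j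
  · exact this j i h.symm (Ne.symm hij) (lt_of_le_of_ne (not_lt.1 hlt) (Ne.symm hij))
  exact Finset.prod_eq_zero (Finset.mem_univ i)
    (Finset.prod_eq_zero (Finset.mem_Ioi.2 hlt) (if_pos h))

/-- In the basis of words indexed by 4-subsets, s pairs nontrivially only with its complement.
Pairing with the word of the complement of t therefore isolates the coefficient of u at t. -/
theorem pairing_nondegenerate {K : Type*} [Field K] [CharZero K] (u : ⋀[K]^4 (Fin 8 → K))
    (h : ∀ v, pairing K u v = 0) : u = 0 := by
  let b := (Pi.basisFun K (Fin 8)).exteriorPower 4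
  have hb : ∀ s, ∃ α : Fin 4 → Fin 8, b s = word K α ∧ Function.Injective α ∧
      ∀ x, (∃ k, α k = x) ↔ x ∈ s := by
    intro s
    refine ⟨Set.powersetCard.ofFinEmbEquiv.symm s, ?_,
      (Set.powersetCard.ofFinEmbEquiv.symm s).injective, fun x => ?_⟩
    · rw [exteriorPower.basis_apply, exteriorPower.ιMulti_family, word]
      congr 1
      funext k
      simp
    · exact Set.powersetCard.mem_range_ofFinEmbEquiv_symm_iff_mem s x
  choose α hα hinj hmem using hb
  have hc : ∀ s : Set.powersetCard (Fin 8) 4, (s.1ᶜ).card = 4 := by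
    intro s
    rw [Finset.card_compl, s.2]; rfl
  have happ : ∀ s t : Set.powersetCard (Fin 8) 4, Function.Injective
      (Fin.append (α s) (α ⟨t.1ᶜ, hc t⟩) : Fin 8 → Fin 8) ↔ s = t := by
    intro s t
    rw [show Function.Injective (Fin.append (α s) (α ⟨t.1ᶜ, hc t⟩) : Fin 8 → Fin 8) ↔ _ from
      Fin.append_injective_iff]
    constructor
    · rintro ⟨-, -, h3⟩
      refine Subtype.ext (Finset.eq_of_subset_of_card_le (fun x hx => ?_) (by rw [s.2, t.2]))
      by_contra hxt
      obtain ⟨k, hk⟩ := (hmem s x).2 hx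
      obtain ⟨l, hl⟩ := (hmem ⟨t.1ᶜ, hc t⟩ x).2 (Finset.mem_compl.2 hxt)
      exact h3 k l (hk.trans hl.symm)
    · rintro rfl
      refine ⟨hinj _, hinj _, fun k l hkl => ?_⟩
      have h1 : α s k ∈ s.1 := (hmem s _).1 ⟨k, rfl⟩
      have h2 : α s k ∈ s.1ᶜ := (hmem ⟨s.1ᶜ, hc s⟩ _).1 ⟨l, hkl.symm⟩
      exact Finset.mem_compl.1 h2 h1
  apply b.repr.injective
  ext t
  have h1 := h (word K (α ⟨t.1ᶜ, hc t⟩))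
  rw [← b.sum_repr u, map_sum, LinearMap.sum_apply, Finset.sum_eq_single t] at h1
  · rw [map_smul, LinearMap.smul_apply, hα, pairing_word, smul_eq_mul] at h1
    rw [map_zero, Finsupp.zero_apply]
    exact (mul_eq_zero.1 h1).resolve_right
      (Int.cast_ne_zero.2 (wordSign_ne_zero ((happ t t).2 rfl)))
  · intro s _ hst
    rw [map_smul, LinearMap.smul_apply, hα, pairing_word,
      wordSign_eq_zero fun hi => hst ((happ s t).1 hi), Int.cast_zero, smul_zero]
  · simp

instance (K : Type*) [Field K] : FiniteDimensional K (E7 K) :=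
  inferInstanceAs (FiniteDimensional K (LieAlgebra.SpecialLinear.sl (Fin 8) K × ⋀[K]^4 (Fin 8 → K)))

/-! ### Existence of homogeneous triples -/

namespace E7

theorem lie_mk_zero_mk_zero {K : Type*} [Field K] [CharZero K] (u v : ⋀[K]^4 (Fin 8 → K)) :
    ⁅(mk 0 u : E7 K), mk 0 v⁆ = mk (momentSl K u v) 0 := by
  apply ext
  · rw [toSl_lie]; simp
  · rw [toForm_lie]; simp

theorem lie_mk_mk_zero {K : Type*} [Field K] [CharZero K] (A : LieAlgebra.SpecialLinear.sl (Fin 8) K)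
    (v : ⋀[K]^4 (Fin 8 → K)) : ⁅mk A 0, (mk 0 v : E7 K)⁆ = mk 0 (act K (A : Matrix _ _ K) v) := by
  apply ext
  · rw [toSl_lie]; simp [coe_momentSl]
  · rw [toForm_lie]; simp

theorem lie_mk_zero_mk {K : Type*} [Field K] [CharZero K] (A : LieAlgebra.SpecialLinear.sl (Fin 8) K)
    (v : ⋀[K]^4 (Fin 8 → K)) : ⁅(mk 0 v : E7 K), mk A 0⁆ = mk 0 (-act K (A : Matrix _ _ K) v) := by
  rw [← lie_skew, lie_mk_mk_zero]
  apply ext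
  · simp
  · simp

/-- Both sides equal tr(μ(u, w) μ(u, v)). Since (ad u)² v = −μ(u, v)·u, this is the self-adjointness
of (ad u)² on ⋀⁴ K⁸. -/
theorem pairing_act_momentSl_comm {K : Type*} [Field K] [CharZero K]
    (u v w : ⋀[K]^4 (Fin 8 → K)) :
    pairing K (act K (momentSl K u v : Matrix _ _ K) u) w =
      pairing K (act K (momentSl K u w : Matrix _ _ K) u) v := by
  have h : ∀ v w : ⋀[K]^4 (Fin 8 → K), pairing K (act K (momentSl K u v : Matrix _ _ K) u) w =
      ((momentSl K u w : Matrix (Fin 8) (Fin 8) K) * (momentSl K u v : Matrix (Fin 8) (Fin 8) K)).trace := by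
    intro v w
    have h0 : (momentSl K u v : Matrix (Fin 8) (Fin 8) K).trace = 0 := LinearMap.mem_ker.1 (momentSl K u v).2
    rw [← trace_moment_mul, coe_momentSl u w, sub_mul, Matrix.smul_mul, one_mul, Matrix.trace_sub,
      Matrix.trace_smul, h0, smul_zero, sub_zero]
  rw [h, h, Matrix.trace_mul_comm]

/-- The vanishing of (ad u)² z says that ad u commutes with [ad u, ad z], so ad z ∘ ad u is
nilpotent by Jacobson's lemma. It preserves 𝔰𝔩₈ and acts there as −`momentAct z u`, whose trace is a
nonzero multiple of the pairing. -/
theorem pairing_eq_zero_of_lie_lie_eq_zero {K : Type*} [Field K] [CharZero K]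
    (u z : ⋀[K]^4 (Fin 8 → K)) (hn : IsNilpotent (LieAlgebra.ad K (E7 K) (mk 0 u)))
    (hz : ⁅(mk 0 u : E7 K), ⁅(mk 0 u : E7 K), (mk 0 z : E7 K)⁆⁆ = 0) : pairing K z u = 0 := by
  have hc : Commute (LieAlgebra.ad K (E7 K) (mk 0 u))
      (LieAlgebra.ad K (E7 K) (mk 0 u) * LieAlgebra.ad K (E7 K) (mk 0 z) -
        LieAlgebra.ad K (E7 K) (mk 0 z) * LieAlgebra.ad K (E7 K) (mk 0 u)) := by
    have h1 : LieAlgebra.ad K (E7 K) (mk 0 u) * LieAlgebra.ad K (E7 K) (mk 0 z) -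
        LieAlgebra.ad K (E7 K) (mk 0 z) * LieAlgebra.ad K (E7 K) (mk 0 u) =
        LieAlgebra.ad K (E7 K) ⁅(mk 0 u : E7 K), (mk 0 z : E7 K)⁆ := by
      refine LinearMap.ext fun x => ?_
      change ⁅(mk 0 u : E7 K), ⁅(mk 0 z : E7 K), x⁆⁆ - ⁅(mk 0 z : E7 K), ⁅(mk 0 u : E7 K), x⁆⁆ =
        ⁅⁅(mk 0 u : E7 K), (mk 0 z : E7 K)⁆, x⁆
      rw [lie_lie]
    rw [h1]
    refine LinearMap.ext fun x => ?_
    change ⁅(mk 0 u : E7 K), ⁅⁅(mk 0 u : E7 K), (mk 0 z : E7 K)⁆, x⁆⁆ =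
      ⁅⁅(mk 0 u : E7 K), (mk 0 z : E7 K)⁆, ⁅(mk 0 u : E7 K), x⁆⁆
    rw [leibniz_lie, hz, zero_lie, zero_add]
  obtain ⟨n, hP⟩ := isNilpotent_mul_of_commute_commutator (K := K) hn hc
  set P := LieAlgebra.ad K (E7 K) (mk 0 z) * LieAlgebra.ad K (E7 K) (mk 0 u)
  have h1 : ∀ A : LieAlgebra.SpecialLinear.sl (Fin 8) K, (-P) (mk A 0) =
      mk (momentSl K z (act K (A : Matrix _ _ K) u)) 0 := by
    intro A
    change -⁅(mk 0 z : E7 K), ⁅(mk 0 u : E7 K), mk A 0⁆⁆ = _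
    rw [lie_mk_zero_mk, lie_mk_zero_mk_zero]
    apply ext
    · rw [map_neg, coe_neg, toSl_mk, toSl_mk, coe_momentSl, coe_momentSl, map_neg, map_neg]
      module
    · simp
  have h2 : ∀ (k : ℕ) (A : LieAlgebra.SpecialLinear.sl (Fin 8) K),
      (toSl K (((-P) ^ k) (mk A 0)) : Matrix _ _ K) = (momentAct z u ^ k) (A : Matrix _ _ K) := by
    intro k
    induction k with
    | zero => intro A; rfl
    | succ k ih =>
      intro A
      rw [pow_succ, Module.End.mul_apply, h1, ih, pow_succ, Module.End.mul_apply, momentAct_apply]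
  -- The extra factor carries an arbitrary matrix into 𝔰𝔩₈, where the comparison with P applies.
  have h3 : IsNilpotent (momentAct z u) := by
    refine ⟨n + 1, LinearMap.ext fun A => ?_⟩
    rw [pow_succ, Module.End.mul_apply, momentAct_apply, ← h2, neg_pow, hP]
    simp
  have h4 := (LinearMap.isNilpotent_trace_of_isNilpotent h3).eq_zero
  rw [trace_momentAct] at h4
  simpa using h4

/-- If u were outside the image of (ad u)², a functional would vanish on the image but not at u. By
nondegeneracy it is pairing with some z, and self-adjointness puts z in the kernel of (ad u)², so z
is orthogonal to u after all. -/
theorem exists_lie_lie_eq_self {K : Type*} [Field K] [CharZero K] (u : ⋀[K]^4 (Fin 8 → K))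
    (hn : IsNilpotent (LieAlgebra.ad K (E7 K) (mk 0 u))) :
    ∃ v, ⁅(mk 0 u : E7 K), ⁅(mk 0 u : E7 K), (mk 0 v : E7 K)⁆⁆ = mk 0 u := by
  let T : Module.End K (⋀[K]^4 (Fin 8 → K)) := toForm K ∘ₗ LieAlgebra.ad K (E7 K) (mk 0 u) ∘ₗ
    LieAlgebra.ad K (E7 K) (mk 0 u) ∘ₗ LinearMap.inr K _ _
  have hT : ∀ v, T v = -act K (momentSl K u v : Matrix _ _ K) u := by
    intro v
    change toForm K ⁅(mk 0 u : E7 K), ⁅(mk 0 u : E7 K), (mk 0 v : E7 K)⁆⁆ = _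
    rw [lie_mk_zero_mk_zero, lie_mk_zero_mk, toForm_mk]
  have hT' : ∀ v, ⁅(mk 0 u : E7 K), ⁅(mk 0 u : E7 K), (mk 0 v : E7 K)⁆⁆ = mk 0 (T v) := by
    intro v
    rw [lie_mk_zero_mk_zero, lie_mk_zero_mk, hT]
  suffices h : u ∈ LinearMap.range T by
    obtain ⟨v, hv⟩ := h
    exact ⟨v, by rw [hT', hv]⟩
  by_contra hu
  obtain ⟨l, hl, hl'⟩ := Submodule.exists_dual_map_eq_bot_of_notMem hu inferInstance
  have hinj : Function.Injective (pairing K) := by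
    refine (injective_iff_map_eq_zero _).2 fun a ha => pairing_nondegenerate a fun v => ?_
    rw [ha, LinearMap.zero_apply]
  obtain ⟨z, rfl⟩ := (LinearMap.injective_iff_surjective_of_finrank_eq_finrank
    (Subspace.dual_finrank_eq (K := K)).symm).1 hinj l
  refine hl (pairing_eq_zero_of_lie_lie_eq_zero u z hn ?_)
  have hTz : T z = 0 := by
    refine pairing_nondegenerate _ fun v => ?_
    have h1 : pairing K z (T v) = 0 := by
      have : pairing K z (T v) ∈ Submodule.map (pairing K z) (LinearMap.range T) :=
        Submodule.mem_map_of_mem (LinearMap.mem_range_self T v)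
      rwa [hl', Submodule.mem_bot] at this
    rw [← h1, pairing_comm z, hT, hT, map_neg, map_neg, LinearMap.neg_apply, LinearMap.neg_apply,
      pairing_act_momentSl_comm]
  rw [hT', hTz]
  rfl

theorem exists_isHomogeneousSl2Triple {K : Type*} [Field K] [CharZero K] (e : E7 K)
    (he : e ∈ gOne K) (hn : IsNilpotent (LieAlgebra.ad K (E7 K) e)) :
    ∃ h f : E7 K, IsHomogeneousSl2Triple h e f := by
  obtain ⟨u, rfl⟩ : ∃ u, e = mk 0 u := by
    refine ⟨toForm K e, ext ?_ rfl⟩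
    rw [(mem_gOne e).1 he, toSl_mk]
  obtain ⟨v, hv⟩ := exists_lie_lie_eq_self u hn
  -- The factor −2 makes [h, e] = −[e, h] equal to 2 (ad e)² v = 2e.
  obtain ⟨A, hA⟩ : ∃ A, ⁅(mk 0 u : E7 K), (-2 : K) • (mk 0 v : E7 K)⁆ = mk A 0 := by
    refine ⟨(-2 : K) • momentSl K u v, ?_⟩
    rw [lie_smul, lie_mk_zero_mk_zero]
    apply ext
    · rfl
    · simp
  have hAe : ⁅(mk A 0 : E7 K), (mk 0 u : E7 K)⁆ = (2 : K) • mk 0 u := by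
    rw [← hA, ← lie_skew, lie_smul, lie_smul, hv, neg_smul, neg_neg]
  obtain ⟨f, hf1, hf2⟩ := LieAlgebra.exists_sl2_completion hAe hA hn
  -- Morozov's f need not be homogeneous. Its odd component satisfies the same relations, because h
  -- is even and e is odd.
  refine ⟨mk A 0, mk 0 (toForm K f), (mem_gZero _).2 rfl, he, (mem_gOne _).2 rfl, hAe, ?_, ?_⟩
  · have h1 := congrArg (toForm K) hf1
    rw [toForm_lie] at h1
    rw [lie_mk_mk_zero]
    apply ext
    · simp
    · simpa using h1
  · have h1 := congrArg (fun x => (toSl K x : Matrix (Fin 8) (Fin 8) K)) hf2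
    simp only [toSl_lie] at h1
    rw [lie_mk_zero_mk_zero]
    apply ext
    · simpa using h1
    · rfl

end E7

end

end SplitE7

/-! ### Continuity and determinant preliminaries -/

theorem MultilinearMap.continuous_of_pi {K : Type*} [NormedField K] {m n : ℕ}
    (f : MultilinearMap K (fun _ : Fin m => Fin n → K) K) : Continuous f := by
  have h : ∀ v, f v = ∑ r : Fin m → Fin n, (∏ i, v i (r i)) * f fun i => Pi.single (r i) 1 := by
    intro v
    have hv : v = fun i => ∑ j, v i j • (Pi.single j 1 : Fin n → K) := by
      funext i
      exact pi_eq_sum_univ' (v i)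
    conv_lhs => rw [hv, f.map_sum]
    refine Finset.sum_congr rfl fun r _ => ?_
    rw [f.map_smul_univ, smul_eq_mul]
  rw [show (f : (Fin m → Fin n → K) → K) = _ from funext h]
  fun_prop

/-- The determinant is the value at 1 of the characteristic polynomial of −N, which is a power of X.
-/
theorem Matrix.det_one_add_of_isNilpotent {K n : Type*} [Field K] [Fintype n] [DecidableEq n]
    {N : Matrix n n K} (h : IsNilpotent N) : (1 + N).det = 1 := by
  have h1 := (Matrix.isNilpotent_charpoly_sub_pow_of_isNilpotent h.neg).eq_zero
  have h2 := Matrix.eval_charpoly (-N) 1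
  rw [sub_eq_zero.1 h1] at h2
  simpa using h2.symm

/-! ### The filtration of matrices by weights of H -/

namespace Matrix

/-- The span of the matrices `X` with `H * X - X * H = i • X` for a natural number `i ≥ k`. -/
def weightFiltration {K n : Type*} [Field K] [Fintype n] (H : Matrix n n K) (k : ℕ) :
    Submodule K (Matrix n n K) :=
  Submodule.span K {X | ∃ i : ℕ, k ≤ i ∧ H * X - X * H = (i : K) • X}

variable {K n : Type*} [Field K] [Fintype n] {H : Matrix n n K}

theorem weightFiltration_mono {k l : ℕ} (h : k ≤ l) :
    weightFiltration H l ≤ weightFiltration H k :=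
  Submodule.span_mono fun _ ⟨i, hi, hX⟩ => ⟨i, h.trans hi, hX⟩

theorem self_mem_weightFiltration : H ∈ weightFiltration H 0 :=
  Submodule.subset_span ⟨0, le_rfl, by simp⟩

variable [DecidableEq n]

theorem one_mem_weightFiltration : (1 : Matrix n n K) ∈ weightFiltration H 0 :=
  Submodule.subset_span ⟨0, le_rfl, by simp⟩

theorem mul_mem_weightFiltration {k l : ℕ} {X Y : Matrix n n K} (hX : X ∈ weightFiltration H k)
    (hY : Y ∈ weightFiltration H l) : X * Y ∈ weightFiltration H (k + l) := by
  have h := Submodule.mul_mem_mul hX hY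
  rw [weightFiltration, weightFiltration, Submodule.span_mul_span] at h
  refine Submodule.span_mono ?_ h
  rintro _ ⟨X, ⟨i, hi, hX⟩, Y, ⟨j, hj, hY⟩, rfl⟩
  refine ⟨i + j, add_le_add hi hj, ?_⟩
  have : H * (X * Y) - X * Y * H = (H * X - X * H) * Y + X * (H * Y - Y * H) := by noncomm_ring
  change H * (X * Y) - X * Y * H = _
  rw [this, hX, hY, Matrix.smul_mul, Matrix.mul_smul, ← add_smul, Nat.cast_add]

theorem pow_mem_weightFiltration {k : ℕ} {X : Matrix n n K} (hX : X ∈ weightFiltration H k)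
    (m : ℕ) : X ^ m ∈ weightFiltration H (m * k) := by
  induction m with
  | zero => simpa using one_mem_weightFiltration
  | succ m ih =>
    rw [pow_succ, add_mul, one_mul]
    exact mul_mem_weightFiltration ih hX

variable (H) in
omit [DecidableEq n] in
theorem exists_weightFiltration_eq_bot [CharZero K] : ∃ N, weightFiltration H N = ⊥ := by
  let T : Module.End K (Matrix n n K) :=
    { toFun := fun X => H * X - X * H
      map_add' := fun X Y => by simp only [mul_add, add_mul]; abel
      map_smul' := fun c X => by simp [smul_sub] }
  obtain ⟨N, hN⟩ := T.exists_forall_ge_eq_zero_of_eq_smul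
  refine ⟨N, (Submodule.eq_bot_iff _).2 fun X hX => ?_⟩
  have : weightFiltration H N ≤ ⊥ := by
    refine Submodule.span_le.2 ?_
    rintro X ⟨i, hi, hX⟩
    exact hN i hi X hX
  exact this hX

theorem isNilpotent_of_mem_weightFiltration [CharZero K] {k : ℕ} (hk : 1 ≤ k) {X : Matrix n n K}
    (hX : X ∈ weightFiltration H k) : IsNilpotent X := by
  obtain ⟨N, hN⟩ := exists_weightFiltration_eq_bot H
  refine ⟨N, ?_⟩
  have h := weightFiltration_mono (Nat.le_mul_of_pos_right N hk) (pow_mem_weightFiltration hX N)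
  rwa [hN, Submodule.mem_bot] at h

/-- A component of weight i is multiplied by 1 − i/k, which vanishes for the lowest weight i = k. -/
theorem add_lie_inv_smul_mem_weightFiltration [CharZero K] {k : ℕ} (hk : 1 ≤ k)
    {X : Matrix n n K} (hX : X ∈ weightFiltration H k) :
    X + (((k : K)⁻¹ • X) * H - H * ((k : K)⁻¹ • X)) ∈ weightFiltration H (k + 1) := by
  have hk0 : (k : K) ≠ 0 := Nat.cast_ne_zero.2 (by omega)
  refine Submodule.span_induction ?_ ?_ ?_ ?_ hX
  · rintro X ⟨i, hi, hX⟩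
    have h1 : X + (((k : K)⁻¹ • X) * H - H * ((k : K)⁻¹ • X)) = (1 - (k : K)⁻¹ * i) • X := by
      rw [Matrix.smul_mul, Matrix.mul_smul, ← smul_sub, ← neg_sub (H * X), hX]
      module
    rw [h1]
    rcases hi.eq_or_lt with rfl | hi
    · rw [inv_mul_cancel₀ hk0, sub_self, zero_smul]; exact zero_mem _
    · exact Submodule.smul_mem _ _ (Submodule.subset_span ⟨i, hi, hX⟩)
  · simp
  · intro X Y _ _ hX hY
    convert add_mem hX hY using 1
    simp only [smul_add, add_mul, mul_add]
    abel
  · intro c X _ hX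
    convert Submodule.smul_mem _ c hX using 1
    simp only [smul_add, smul_sub, Matrix.smul_mul, Matrix.mul_smul, smul_comm c]

end Matrix

/-! ### Exponentials of matrices of positive weight -/

section Exp

attribute [local instance] Matrix.linftyOpNormedRing Matrix.linftyOpNormedAlgebra

namespace Matrix

variable {K n : Type*} [RCLike K] [Fintype n] [DecidableEq n] {H : Matrix n n K}

theorem exp_mul_exp_neg (Z : Matrix n n K) : NormedSpace.exp Z * NormedSpace.exp (-Z) = 1 := by
  rw [← Matrix.exp_add_of_commute _ _ (Commute.neg_right (Commute.refl Z)), add_neg_cancel,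
    NormedSpace.exp_zero]

theorem exp_sub_mem_weightFiltration {k : ℕ} (hk : 1 ≤ k) {Z : Matrix n n K}
    (hZ : Z ∈ weightFiltration H k) :
    NormedSpace.exp Z - 1 - Z ∈ weightFiltration H (k + 1) := by
  obtain ⟨N, hN⟩ := isNilpotent_of_mem_weightFiltration hk hZ
  -- Two terms beyond the nilpotency bound are kept so that degrees 0 and 1 can be split off for
  -- every N. The remaining powers have weight at least 2k ≥ k + 1.
  have h1 : NormedSpace.exp Z = ∑ m ∈ Finset.range (N + 2), ((m.factorial : K)⁻¹) • Z ^ m := by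
    rw [NormedSpace.exp_eq_tsum K]
    refine tsum_eq_sum fun m hm => ?_
    rw [pow_eq_zero_of_le (by simp at hm; omega) hN, smul_zero]
  have h2 : NormedSpace.exp Z - 1 - Z =
      ∑ m ∈ Finset.range N, (((m + 2).factorial : K)⁻¹) • Z ^ (m + 2) := by
    rw [h1, Finset.sum_range_succ', Finset.sum_range_succ']
    simp
  rw [h2]
  refine Submodule.sum_mem _ fun m _ => Submodule.smul_mem _ _ ?_
  refine weightFiltration_mono ?_ (pow_mem_weightFiltration hZ (m + 2))
  nlinarith

theorem exp_sub_one_mem_weightFiltration {k : ℕ} (hk : 1 ≤ k) {Z : Matrix n n K}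
    (hZ : Z ∈ weightFiltration H k) : NormedSpace.exp Z - 1 ∈ weightFiltration H k := by
  rw [← sub_add_cancel (NormedSpace.exp Z - 1) Z]
  exact add_mem (weightFiltration_mono (Nat.le_succ k) (exp_sub_mem_weightFiltration hk hZ)) hZ

theorem exp_mem_weightFiltration {k : ℕ} (hk : 1 ≤ k) {Z : Matrix n n K}
    (hZ : Z ∈ weightFiltration H k) : NormedSpace.exp Z ∈ weightFiltration H 0 := by
  rw [← sub_add_cancel (NormedSpace.exp Z) 1]
  exact add_mem (weightFiltration_mono (Nat.zero_le k) (exp_sub_one_mem_weightFiltration hk hZ))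
    one_mem_weightFiltration

theorem det_exp_of_mem_weightFiltration {k : ℕ} (hk : 1 ≤ k) {Z : Matrix n n K}
    (hZ : Z ∈ weightFiltration H k) : (NormedSpace.exp Z).det = 1 := by
  rw [← add_sub_cancel 1 (NormedSpace.exp Z)]
  exact det_one_add_of_isNilpotent
    (isNilpotent_of_mem_weightFiltration hk (exp_sub_one_mem_weightFiltration hk hZ))

/-- With d = H' − H and Z = d/k, the conjugate of H' is H + d + [Z, H] up to terms of weight at
least k + 1, and `add_lie_inv_smul_mem_weightFiltration` puts d + [Z, H] among those terms. -/
theorem exp_conj_sub_mem_weightFiltration {k : ℕ} (hk : 1 ≤ k) {H' : Matrix n n K}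
    (hd : H' - H ∈ weightFiltration H k) :
    NormedSpace.exp ((k : K)⁻¹ • (H' - H)) * H' * NormedSpace.exp (-((k : K)⁻¹ • (H' - H))) - H ∈
      weightFiltration H (k + 1) := by
  set d := H' - H with hd'
  set Z := (k : K)⁻¹ • d with hZ'
  have hZ : Z ∈ weightFiltration H k := Submodule.smul_mem _ _ hd
  have h1 := exp_mul_exp_neg Z
  have h2 := exp_sub_mem_weightFiltration hk hZ
  have h3 := exp_sub_one_mem_weightFiltration hk hZ
  have h4 := exp_mem_weightFiltration hk (neg_mem hZ)
  have h5 := add_lie_inv_smul_mem_weightFiltration hk hd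
  rw [← hZ'] at h5
  -- Factoring out exp(−Z), which has nonnegative weights, leaves only exp Z to be expanded.
  have h6 : NormedSpace.exp Z * H' * NormedSpace.exp (-Z) - H =
      (NormedSpace.exp Z * H' - H * NormedSpace.exp Z) * NormedSpace.exp (-Z) := by
    rw [sub_mul, mul_assoc H, h1, mul_one]
  have h7 : NormedSpace.exp Z * H' - H * NormedSpace.exp Z =
      d + (Z * H - H * Z) + ((NormedSpace.exp Z - 1 - Z) * H - H * (NormedSpace.exp Z - 1 - Z)) +
        (NormedSpace.exp Z - 1) * d := by
    rw [hd']
    noncomm_ring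
  rw [h6, h7]
  refine mul_mem_weightFiltration (l := 0) (add_mem (add_mem h5 (sub_mem ?_ ?_)) ?_) h4
  · exact mul_mem_weightFiltration (l := 0) h2 self_mem_weightFiltration
  · rw [← zero_add (k + 1)]
    exact mul_mem_weightFiltration self_mem_weightFiltration h2
  · exact weightFiltration_mono (by omega) (mul_mem_weightFiltration h3 hd)

end Matrix

/-! ### Conjugacy of homogeneous triples with the same e -/

namespace SplitE7

namespace E7

/-- Composing with a functional keeps the curve scalar-valued, so the exterior power needs no
topology. On a word the curve is a multilinear form evaluated at four curves in K⁸, and the product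
rule reproduces the derivation action. -/
theorem hasDerivAt_gAct_exp {K : Type*} [RCLike K] (Z : Matrix (Fin 8) (Fin 8) K)
    (l : Module.Dual K (⋀[K]^4 (Fin 8 → K))) (w : ⋀[K]^4 (Fin 8 → K)) (t : K) :
    HasDerivAt (fun s : K => l (gAct (NormedSpace.exp (s • Z)) w))
      (l (gAct (NormedSpace.exp (t • Z)) (act K Z w))) t := by
  let N : Submodule K (⋀[K]^4 (Fin 8 → K)) :=
    { carrier := {w | HasDerivAt (fun s : K => l (gAct (NormedSpace.exp (s • Z)) w))
        (l (gAct (NormedSpace.exp (t • Z)) (act K Z w))) t}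
      add_mem' := fun {x y} hx hy => by
        simp only [Set.mem_ofPred_eq, map_add] at *
        exact hx.add hy
      zero_mem' := by
        simp only [Set.mem_ofPred_eq, map_zero]
        exact hasDerivAt_const _ _
      smul_mem' := fun c x hx => by
        simp only [Set.mem_ofPred_eq, map_smul] at *
        exact hx.const_smul c }
  change w ∈ N
  refine span_words N (fun α _ => ?_) w
  change HasDerivAt _ _ t
  set v : Fin 4 → Fin 8 → K := fun k => Pi.single (α k) 1
  let f : ContinuousMultilinearMap K (fun _ : Fin 4 => Fin 8 → K) K :=
    { (l.compAlternatingMap (exteriorPower.ιMulti K 4)).toMultilinearMap with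
      cont := MultilinearMap.continuous_of_pi
        (l.compAlternatingMap (exteriorPower.ιMulti K 4)).toMultilinearMap }
  have hf : ∀ x, f x = l (exteriorPower.ιMulti K 4 x) := fun x => rfl
  have h1 : ∀ i, HasDerivAt (fun s : K => (NormedSpace.exp (s • Z)).mulVec (v i))
      ((NormedSpace.exp (t • Z)).mulVec (Z.mulVec (v i))) t := by
    intro i
    let L : Matrix (Fin 8) (Fin 8) K →L[K] (Fin 8 → K) :=
      LinearMap.toContinuousLinearMap ((Matrix.mulVecBilin K K).flip (v i))
    have h2 := L.hasFDerivAt.comp_hasDerivAt t (hasDerivAt_exp_smul_const (𝕂 := K) Z t)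
    rw [Matrix.mulVec_mulVec]
    exact h2
  have h2 := (HasFDerivAt.multilinear_comp f fun i => (h1 i).hasFDerivAt).hasDerivAt
  have h3 : ∀ s : K, l (gAct (NormedSpace.exp (s • Z)) (word K α)) =
      f fun i => (NormedSpace.exp (s • Z)).mulVec (v i) := by
    intro s
    rw [word, gAct_ιMulti, hf]
  simp only [h3]
  convert! h2 using 1
  rw [word, act_ιMulti, map_sum, map_sum, sum_apply]
  refine Finset.sum_congr rfl fun i _ => ?_
  rw [gAct_ιMulti, ContinuousLinearMap.comp_apply]
  change _ = f _
  rw [hf]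
  congr 2
  funext j
  by_cases hj : j = i
  · subst hj; simp [v]
  · simp [hj, v]

/-- Every functional is constant along t ↦ exp(tZ)·w, since its derivative factors through Z·w = 0.
-/
theorem gAct_exp_eq_self {K : Type*} [RCLike K] {Z : Matrix (Fin 8) (Fin 8) K}
    {w : ⋀[K]^4 (Fin 8 → K)} (h : act K Z w = 0) : gAct (NormedSpace.exp Z) w = w := by
  rw [← sub_eq_zero, ← Module.forall_dual_apply_eq_zero_iff K]
  intro l
  have h1 := hasDerivAt_gAct_exp Z l w
  simp only [h, map_zero] at h1
  have h2 := is_const_of_deriv_eq_zero (fun t => (h1 t).differentiableAt) (fun t => (h1 t).deriv) 1 0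
  rw [one_smul, zero_smul, NormedSpace.exp_zero, gAct_one] at h2
  rw [map_sub, h2, sub_self]

theorem smul_lie {K : Type*} [Field K] [CharZero K] (g : Matrix.SpecialLinearGroup (Fin 8) K)
    (x y : E7 K) : g • ⁅x, y⁆ = ⁅g • x, g • y⁆ := slMap_lie g x y

theorem smul_smul_comm {K : Type*} [Field K] [CharZero K] (g : Matrix.SpecialLinearGroup (Fin 8) K)
    (c : K) (x : E7 K) : g • (c • x) = c • (g • x) := map_smul (slMap g) c x

theorem IsHomogeneousSl2Triple.smul {K : Type*} [Field K] [CharZero K] {h e f : E7 K}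
    (t : IsHomogeneousSl2Triple h e f) (g : Matrix.SpecialLinearGroup (Fin 8) K) :
    IsHomogeneousSl2Triple (g • h) (g • e) (g • f) where
  h_mem := by
    rw [mem_gZero, toForm_smul, (mem_gZero h).1 t.h_mem, map_zero]
  e_mem := by
    rw [mem_gOne]
    apply Subtype.ext
    rw [toSl_smul, (mem_gOne e).1 t.e_mem]
    simp
  f_mem := by
    rw [mem_gOne]
    apply Subtype.ext
    rw [toSl_smul, (mem_gOne f).1 t.f_mem]
    simp
  lie_h_e := by rw [← smul_lie, t.lie_h_e, smul_smul_comm]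
  lie_h_f := by
    rw [← smul_lie, t.lie_h_f, ← neg_smul, smul_smul_comm, neg_smul]
  lie_e_f := by rw [← smul_lie, t.lie_e_f]

/-- The difference of the two candidates commutes with e and has weight −2, which the centralizer of
e does not allow. -/
theorem IsHomogeneousSl2Triple.f_unique {K : Type*} [Field K] [CharZero K] {h e f f' : E7 K}
    (t : IsHomogeneousSl2Triple h e f) (t' : IsHomogeneousSl2Triple h e f') : f' = f := by
  rw [← sub_eq_zero]
  refine LieAlgebra.eq_zero_of_lie_eq_neg_two_smul (K := K) t.lie_h_e t.lie_e_f
    (LieAlgebra.isNilpotent_ad_of_lie_eq_two_smul t.lie_h_e) ?_ ?_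
  · rw [lie_sub, t.lie_e_f, t'.lie_e_f, sub_self]
  · rw [lie_sub, t.lie_h_f, t'.lie_h_f, smul_sub]
    abel

/-- For even h the projection to 𝔰𝔩₈ turns ad h into the matrix commutator with h, so eigenvectors
project to eigenvectors or zero. -/
theorem toSl_mem_weightFiltration {K : Type*} [Field K] [CharZero K] {h e x : E7 K}
    (hh : h ∈ gZero K) {k : ℕ} (hx : x ∈ LieAlgebra.centralizerFiltration K h e k) :
    (toSl K x : Matrix (Fin 8) (Fin 8) K) ∈
      Matrix.weightFiltration (toSl K h : Matrix (Fin 8) (Fin 8) K) k := by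
  refine Submodule.span_induction ?_ ?_ ?_ ?_ hx
  · rintro x ⟨-, i, hi, hx⟩
    refine Submodule.subset_span ⟨i, hi, ?_⟩
    have h1 := congrArg (fun y => (toSl K y : Matrix (Fin 8) (Fin 8) K)) hx
    simp only [toSl_lie, (mem_gZero h).1 hh] at h1
    simpa [coe_momentSl] using h1
  · rw [map_zero]; exact zero_mem _
  · intro x y _ _ hx hy
    rw [map_add]; exact add_mem hx hy
  · intro c x _ hx
    rw [map_smul]; exact Submodule.smul_mem _ c hx

theorem IsHomogeneousSl2Triple.act_toSl {K : Type*} [Field K] [CharZero K] {h e f : E7 K}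
    (t : IsHomogeneousSl2Triple h e f) :
    act K (toSl K h : Matrix (Fin 8) (Fin 8) K) (toForm K e) = (2 : K) • toForm K e := by
  have h1 := congrArg (toForm K) t.lie_h_e
  rw [toForm_lie, (mem_gOne e).1 t.e_mem] at h1
  simpa using h1

/-- Successive approximation: each conjugation raises the lowest possible weight of h' − h by at
least one, and beyond some N no weights remain. The induction is on a bound m for the number of
steps still needed. -/
theorem IsHomogeneousSl2Triple.exists_smul_eq_of_mem_weightFiltration {K : Type*} [RCLike K]
    {h e f h' f' : E7 K} (t : IsHomogeneousSl2Triple h e f) (t' : IsHomogeneousSl2Triple h' e f')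
    {k : ℕ} (hk : 1 ≤ k) (hd : (toSl K h' - toSl K h : Matrix (Fin 8) (Fin 8) K) ∈
      Matrix.weightFiltration (toSl K h : Matrix (Fin 8) (Fin 8) K) k) :
    ∃ g : Matrix.SpecialLinearGroup (Fin 8) K, g • h' = h ∧ g • e = e := by
  obtain ⟨N, hN⟩ := Matrix.exists_weightFiltration_eq_bot (toSl K h : Matrix (Fin 8) (Fin 8) K)
  obtain ⟨m, hm⟩ : ∃ m, N ≤ k + m := ⟨N, by omega⟩
  induction m generalizing k h' f' with
  | zero =>
    have h1 := Matrix.weightFiltration_mono hm hd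
    rw [hN, Submodule.mem_bot, sub_eq_zero] at h1
    refine ⟨1, ?_, one_smul _ _⟩
    rw [one_smul]
    apply ext h1
    rw [(mem_gZero h).1 t.h_mem, (mem_gZero h').1 t'.h_mem]
  | succ m ih =>
    set Z := (k : K)⁻¹ • (toSl K h' - toSl K h : Matrix (Fin 8) (Fin 8) K) with hZ
    have hZm : Z ∈ Matrix.weightFiltration (toSl K h : Matrix (Fin 8) (Fin 8) K) k :=
      Submodule.smul_mem _ _ hd
    let g : Matrix.SpecialLinearGroup (Fin 8) K :=
      ⟨NormedSpace.exp Z, Matrix.det_exp_of_mem_weightFiltration hk hZm⟩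
    have hg : g⁻¹.1 = NormedSpace.exp (-Z) := by
      have h1 : g⁻¹.1 * NormedSpace.exp Z = 1 := congrArg Subtype.val (inv_mul_cancel g)
      exact left_inv_eq_right_inv h1 (Matrix.exp_mul_exp_neg Z)
    -- Both h and h' act on e by 2, so Z annihilates e and its exponential fixes e.
    have hge : g • e = e := by
      apply ext
      · rw [toSl_smul, (mem_gOne e).1 t.e_mem]
        simp
      · rw [toForm_smul]
        refine gAct_exp_eq_self ?_
        rw [hZ, map_smul, map_sub, LinearMap.smul_apply, LinearMap.sub_apply, t.act_toSl,
          t'.act_toSl, sub_self, smul_zero]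
    have t'' := t'.smul g
    rw [hge] at t''
    obtain ⟨g', h1, h2⟩ := ih t'' (k := k + 1) (by omega) (by
      rw [toSl_smul, hg]
      exact Matrix.exp_conj_sub_mem_weightFiltration hk hd) (by omega)
    exact ⟨g' * g, by rw [mul_smul, h1], by rw [mul_smul, hge, h2]⟩

/-- The difference h' − h equals [e, f' − f] and commutes with e, so `mem_centralizerFiltration`
with k = 1 gives it positive weights, where the successive approximation starts. -/
theorem IsHomogeneousSl2Triple.exists_smul_eq {K : Type*} [RCLike K]
    {h e f h' f' : E7 K} (t : IsHomogeneousSl2Triple h e f)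
    (t' : IsHomogeneousSl2Triple h' e f') :
    ∃ g : Matrix.SpecialLinearGroup (Fin 8) K, g • h' = h ∧ g • e = e ∧ g • f' = f := by
  have h1 : h' - h = ((LieAlgebra.ad K (E7 K) e) ^ 1) (f' - f) := by
    rw [pow_one, LieAlgebra.ad_apply, lie_sub, t.lie_e_f, t'.lie_e_f]
  have h2 : ⁅e, h' - h⁆ = 0 := by
    rw [lie_sub, ← lie_skew, ← lie_skew e h, t.lie_h_e, t'.lie_h_e, sub_self]
  have h3 := LieAlgebra.mem_centralizerFiltration t.lie_h_e t.lie_e_f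
    (LieAlgebra.isNilpotent_ad_of_lie_eq_two_smul t.lie_h_e) 1 (f' - f) (by rw [← h1, h2])
  rw [← h1] at h3
  have h4 := toSl_mem_weightFiltration t.h_mem h3
  rw [map_sub] at h4
  obtain ⟨g, hg, hge⟩ := t.exists_smul_eq_of_mem_weightFiltration t' le_rfl h4
  have t'' := t'.smul g
  rw [hg, hge] at t''
  exact ⟨g, hg, hge, t.f_unique t''⟩

theorem IsHomogeneousSl2Triple.conjugate_iff {K : Type*} [RCLike K] {h e f h' e' f' : E7 K}
    (t : IsHomogeneousSl2Triple h e f) (t' : IsHomogeneousSl2Triple h' e' f') :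
    (∃ g : Matrix.SpecialLinearGroup (Fin 8) K, g • e' = e) ↔
      ∃ g : Matrix.SpecialLinearGroup (Fin 8) K, g • h' = h ∧ g • e' = e ∧ g • f' = f := by
  refine ⟨?_, fun ⟨g, hg⟩ => ⟨g, hg.2.1⟩⟩
  -- Translating the second triple by g reduces to two triples with the same e.
  rintro ⟨g, rfl⟩
  obtain ⟨g', h1, h2, h3⟩ := t.exists_smul_eq (t'.smul g)
  exact ⟨g' * g, by rw [mul_smul, h1], by rw [mul_smul, h2], by rw [mul_smul, h3]⟩

end E7

end SplitE7

end Exp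

/-! ### The theorem over ℂ and over ℝ -/

theorem mainTheorem3 :
    ((∀ e ∈ SplitE7.E7.gOne ℂ, IsNilpotent (LieAlgebra.ad ℂ (SplitE7.E7 ℂ) e) →
        ∃ h f : SplitE7.E7 ℂ, SplitE7.E7.IsHomogeneousSl2Triple h e f) ∧
      ∀ h e f h' e' f' : SplitE7.E7 ℂ,
        SplitE7.E7.IsHomogeneousSl2Triple h e f → SplitE7.E7.IsHomogeneousSl2Triple h' e' f' →
        ((∃ g : Matrix.SpecialLinearGroup (Fin 8) ℂ, g • e' = e) ↔
          ∃ g : Matrix.SpecialLinearGroup (Fin 8) ℂ, g • h' = h ∧ g • e' = e ∧ g • f' = f)) ∧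
    ((∀ e ∈ SplitE7.E7.gOne ℝ, IsNilpotent (LieAlgebra.ad ℝ (SplitE7.E7 ℝ) e) →
        ∃ h f : SplitE7.E7 ℝ, SplitE7.E7.IsHomogeneousSl2Triple h e f) ∧
      ∀ h e f h' e' f' : SplitE7.E7 ℝ,
        SplitE7.E7.IsHomogeneousSl2Triple h e f → SplitE7.E7.IsHomogeneousSl2Triple h' e' f' →
        ((∃ g : Matrix.SpecialLinearGroup (Fin 8) ℝ, g • e' = e) ↔
          ∃ g : Matrix.SpecialLinearGroup (Fin 8) ℝ, g • h' = h ∧ g • e' = e ∧ g • f' = f)) := by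
  exact ⟨⟨fun e he hn => SplitE7.E7.exists_isHomogeneousSl2Triple e he hn,
      fun _ _ _ _ _ _ t t' => t.conjugate_iff t'⟩,
    ⟨fun e he hn => SplitE7.E7.exists_isHomogeneousSl2Triple e he hn,
      fun _ _ _ _ _ _ t t' => t.conjugate_iff t'⟩⟩
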